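/- Let $(K,\sigma)$ be a difference field of characteristic $0$ ($\sigma$ a ring endomorphism of $K$), let $K\{Y\}=K[y_j^{(q)} : 1\le j\le n,\ q\in\mathbb N]$ be the difference polynomial ring in $Y=\{y_1,\dots,y_n\}$, with $\sigma$ extended by $\sigma(y_j^{(q)})=y_j^{(q+1)}$, and write $g^{(l)}=\sigma^l(g)$. An ideal $I$ of a difference ring is a difference ideal if $\sigma(I)\subseteq I$; such an ideal is reflexive if $\sigma(a)\in I$ implies $a\in I$, and $\sigma$-prime if it is reflexive and prime. Let $F=(f_1,\dots,f_r)$ be elements of $K\{Y\}$, let $e$ be the maximal order $q$ of a variable $y_j^{(q)}$ occurring in $F$, and assume $e\ge 1$. Let $\mathfrak p$ be minimal among the $\sigma$-prime ideals of $K\{Y\}$ that contain the difference ideal $[F]$ generated by $F$, and let $\kappa=\operatorname{Frac}(K\{Y\}/\mathfrak p)$. For $N\in\mathbb N$ let $A_N=K[y_j^{(q)} : 1\le j\le n,\ q\le N]$ and let $B_N$ be the localization of $A_N$ at the prime $A_N\cap\mathfrak p$. For $m\ge 1$ let $\Delta_m$ be the ideal of $B_{m-1+e}$ generated by the $f_j^{(l)}$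 with $1\le j\le r$, $0\le l\le m-1$, and let $\Delta_0=(0)\subseteq B_{e-1}$. Let $\Delta$ be the difference ideal generated by $F$ in $K\{Y\}_{\mathfrak p}$. For $k\in\mathbb N$ and $i\ge e-1$ let $J_{k,i}$ be the $kr\times kn$ Jacobian matrix of $F^{(i-e+1)},\dots,F^{(i-e+k)}$ with respect to the variables $Y^{(i+1)},\dots,Y^{(i+k)}$, and put $\mu_{k,i}=\dim_\kappa\ker(J_{k,i}^{\tau})$, where $J_{k,i}^{\tau}$ is the transpose. Assume: (a) $F$ is quasi-regular at $\mathfrak p$: for every $k\ge 1$ the Jacobian matrix of the $f_j^{(l)}$ ($1\le j\le r$, $0\le l\le k-1$) with respect to all variables $y_j^{(q)}$, $q\le k-1+e$, has full row rank $kr$ over the domain $A_{k-1+e}/(A_{k-1+e}\cap\mathfrak p)$, and $\Delta$ is reflexive; (b) for all $k\in\mathbb N$ and $i\ge e-1$, the rank of $J_{k,i}$ over the field $\operatorname{Frac}(B_{i+k+s}/\Delta_{i-e+1+k+s})$ does not depend on $s\in\mathbb N$. Then for every $k\in\mathbb N$ and every $i\ge e-1$: the number $\mu_{k,i}$ does not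 depend on $i$ (write $\mu_k$ for it), the ideal $\Delta_{i-e+1+k}$ of $B_{i+k}$ is prime (as is implicit in (b)), and 1. the field extension $\operatorname{Frac}\bigl(B_i/(\Delta_{i-e+1+k}\cap B_i)\bigr)\hookrightarrow\operatorname{Frac}\bigl(B_{i+k}/\Delta_{i-e+1+k}\bigr)$ has transcendence degree $k(n-r)+\mu_k$; 2. $\operatorname{trdeg}_K\operatorname{Frac}\bigl(B_i/(\Delta_{i-e+1+k}\cap B_i)\bigr)=(n-r)(i+1)+er-\mu_k$. -/

import Mathlib

open MvPolynomial

noncomputable section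

namespace DiffAlg

/-! ### Ideals of difference rings -/

section DiffRing

variable {R : Type*} [CommRing R]

/-- `I` is a difference ideal of the difference ring `(R, τ)`. -/
def IsDiffIdeal (τ : R →+* R) (I : Ideal R) : Prop := ∀ a ∈ I, τ a ∈ I

/-- Reflexivity of a difference ideal `I`: if `τ a ∈ I` then `a ∈ I`. -/
def IsReflexive (τ : R →+* R) (I : Ideal R) : Prop := ∀ a, τ a ∈ I → a ∈ I

/-- `I` is a reflexive difference ideal which is prime as an algebraic ideal. -/
structure IsDiffPrime (τ : R →+* R) (I : Ideal R) : Prop where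
  isPrime : I.IsPrime
  isDiffIdeal : IsDiffIdeal τ I
  isReflexive : IsReflexive τ I

/-- The difference ideal generated by a set `S`: the smallest difference ideal containing `S`. -/
def diffSpan (τ : R →+* R) (S : Set R) : Ideal R := sInf {I | S ⊆ I ∧ IsDiffIdeal τ I}

theorem IsDiffPrime.eq_comap {τ : R →+* R} {I : Ideal R} (h : IsDiffPrime τ I) :
    I = I.comap τ :=
  Ideal.ext fun a => ⟨fun ha => h.isDiffIdeal a ha, fun ha => h.isReflexive a ha⟩

end DiffRing

/-- The field of fractions of `R ⧸ P`, for a prime ideal `P` (that is, the residue field of `P`).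
For an arbitrary ideal this is the total ring of fractions of `R ⧸ P`. -/
abbrev ResFrac {R : Type*} [CommRing R] (P : Ideal R) : Type _ := FractionRing (R ⧸ P)

/-- For a ring homomorphism `φ : R → S` and a prime `P` of `S`, the induced embedding
`Frac (R ⧸ φ⁻¹ P) → Frac (S ⧸ P)`. -/
def resFracMap {R S : Type*} [CommRing R] [CommRing S] (φ : R →+* S) (P : Ideal S)
    (hP : P.IsPrime) : ResFrac (P.comap φ) →+* ResFrac P :=
  haveI := hP
  IsFractionRing.map (A := R ⧸ P.comap φ) (B := S ⧸ P)
    (K := ResFrac (P.comap φ)) (L := ResFrac P)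
    (j := Ideal.quotientMap P φ le_rfl) Ideal.quotientMap_injective

/-! ### Difference polynomials -/

section DiffPoly

variable {K : Type*} [Field K] {n : ℕ}

/-- The difference polynomial ring `K{y₁, …, yₙ}`; the variable `(j, q)` is `σ^q (y_j)`. -/
abbrev DiffPoly (K : Type*) [Field K] (n : ℕ) : Type _ := MvPolynomial (Fin n × ℕ) K

/-- The endomorphism of `K{Y}` extending `σ : K → K` with `y_j^{(q)} ↦ y_j^{(q+1)}`. -/
def shift (σ : K →+* K) : DiffPoly K n →+* DiffPoly K n :=
  eval₂Hom (C.comp σ) fun v => X (v.1, v.2 + 1)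

/-- The transform `g^{(l)} = σ^l (g)`. -/
def transform (σ : K →+* K) (l : ℕ) (g : DiffPoly K n) : DiffPoly K n := (shift σ)^[l] g

/-- The maximal difference order occurring in the system `f₁, …, f_r`. -/
def sysOrder {r : ℕ} (f : Fin r → DiffPoly K n) : ℕ :=
  Finset.univ.sup fun j => (f j).vars.sup Prod.snd

/-- The difference polynomials of order at most `N`, as a subalgebra of `K{Y}`. -/
abbrev ordSub (K : Type*) [Field K] (n N : ℕ) : Subalgebra K (DiffPoly K n) :=
  supported K {v : Fin n × ℕ | v.2 ≤ N}

theorem ordSub_mono {M N : ℕ} (h : M ≤ N) : ordSub K n M ≤ ordSub K n N :=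
  supported_mono fun _ hv => le_trans hv h

theorem shift_mem (σ : K →+* K) {N : ℕ} {g : DiffPoly K n} (hg : g ∈ ordSub K n N) :
    shift σ g ∈ ordSub K n (N + 1) := by
  refine Algebra.adjoin_induction (p := fun x _ => shift σ x ∈ ordSub K n (N + 1))
    ?_ ?_ ?_ ?_ hg
  · rintro _ ⟨v, hv, rfl⟩
    have hv' : v.2 ≤ N := hv
    have : shift σ (X v : DiffPoly K n) = X (v.1, v.2 + 1) := by simp [shift]
    rw [this]
    exact Algebra.subset_adjoin ⟨_, Nat.succ_le_succ hv', rfl⟩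
  · intro c
    have : shift σ (algebraMap K (DiffPoly K n) c) = algebraMap K (DiffPoly K n) (σ c) := by
      simp [shift, algebraMap_eq]
    rw [this]
    exact Subalgebra.algebraMap_mem _ _
  · intro x y _ _ hx hy
    rw [map_add]; exact add_mem hx hy
  · intro x y _ _ hx hy
    rw [map_mul]; exact mul_mem hx hy

theorem transform_mem (σ : K →+* K) {r : ℕ} (f : Fin r → DiffPoly K n) (j : Fin r) (l : ℕ) :
    transform σ l (f j) ∈ ordSub K n (l + sysOrder f) := by
  induction l with
  | zero =>
    have : ∀ v ∈ (f j).vars, v.2 ≤ 0 + sysOrder f := fun v hv => by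
      rw [zero_add]
      exact le_trans (Finset.le_sup (f := Prod.snd) hv)
        (Finset.le_sup (f := fun j => (f j).vars.sup Prod.snd) (Finset.mem_univ j))
    exact mem_supported.2 fun v hv => this v hv
  | succ l ih =>
    have h := shift_mem σ ih
    rw [transform, Function.iterate_succ_apply']
    rwa [show l + 1 + sysOrder f = l + sysOrder f + 1 by omega]

theorem pderiv_mem {N : ℕ} (v : Fin n × ℕ) {g : DiffPoly K n} (hg : g ∈ ordSub K n N) :
    pderiv v g ∈ ordSub K n N := by
  classical
  refine Algebra.adjoin_induction (p := fun x _ => pderiv v x ∈ ordSub K n N)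
    ?_ ?_ ?_ ?_ hg
  · rintro _ ⟨w, hw, rfl⟩
    rw [pderiv_X]
    by_cases h : v = w
    · subst h; simp
    · rw [Pi.single_eq_of_ne (by tauto)]; exact zero_mem _
  · intro c
    rw [algebraMap_eq, pderiv_C]; exact zero_mem _
  · intro x y _ _ hx hy
    rw [map_add]; exact add_mem hx hy
  · intro x y hx' hy' hx hy
    rw [pderiv_mul]; exact add_mem (mul_mem hx hy') (mul_mem hx' hy)

variable (σ : K →+* K) {r : ℕ} (f : Fin r → DiffPoly K n)

/-! ### The Jacobian matrices -/

/-- The Jacobian matrix of `f₁^{[k-1]}, …, f_r^{[k-1]}` with respect to `Y^{[k-1+e]}`, `k ≥ 1`.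
The row `(l, j)` belongs to `f_j^{(l)}` and the column `(q, s)` to `y_s^{(q)}`. -/
def fullJac (k : ℕ) : Matrix (Fin k × Fin r) (Fin (k + sysOrder f) × Fin n) (DiffPoly K n) :=
  fun a b => pderiv (b.2, (b.1 : ℕ)) (transform σ a.1 (f a.2))

/-- The pseudo-Jacobian matrix `J_{k,i}` (for `i ≥ e - 1`) of `F^{(i-e+1)}, …, F^{(i-e+k)}` with
respect to `Y^{(i+1)}, …, Y^{(i+k)}`. -/
def pseudoJac (k i : ℕ) : Matrix (Fin k × Fin r) (Fin k × Fin n) (DiffPoly K n) :=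
  fun a b => pderiv (b.2, i + 1 + b.1) (transform σ (i + 1 - sysOrder f + a.1) (f a.2))

theorem fullJac_mem (k : ℕ) (a : Fin k × Fin r) (b : Fin (k + sysOrder f) × Fin n) :
    fullJac σ f k a b ∈ ordSub K n (k - 1 + sysOrder f) :=
  pderiv_mem _ (ordSub_mono (by have := a.1.2; omega) (transform_mem σ f a.2 a.1))

theorem pseudoJac_mem {k i N : ℕ} (hi : sysOrder f ≤ i + 1) (hN : i + k ≤ N)
    (a : Fin k × Fin r) (b : Fin k × Fin n) :
    pseudoJac σ f k i a b ∈ ordSub K n N :=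
  pderiv_mem _ (ordSub_mono (by have := a.1.2; omega) (transform_mem σ f a.2 _))

/-- `A_N = K[Y^{[N]}]`, the polynomial ring in the variables of order at most `N`. -/
abbrev OrdRing (K : Type*) [Field K] (n N : ℕ) : Type _ :=
  MvPolynomial ↥{v : Fin n × ℕ | v.2 ≤ N} K

/-- The inclusion `A_N → K{Y}`. -/
def ordVal (K : Type*) [Field K] (n N : ℕ) : OrdRing K n N →ₐ[K] DiffPoly K n :=
  rename Subtype.val

/-- The inclusion `A_M → A_N` for `M ≤ N`. -/
def ordIncl (K : Type*) [Field K] (n : ℕ) {M N : ℕ} (h : M ≤ N) :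
    OrdRing K n M →ₐ[K] OrdRing K n N :=
  rename fun v => ⟨v.1, le_trans v.2 h⟩

theorem ordVal_ordIncl {M N : ℕ} (h : M ≤ N) (a : OrdRing K n M) :
    ordVal K n N (ordIncl K n h a) = ordVal K n M a :=
  rename_rename _ _ a

/-- A matrix over `K{Y}` with entries in `A_N`, as a matrix over `A_N`. -/
def restrictMat {ι ι' : Type*} {N : ℕ} (M : Matrix ι ι' (DiffPoly K n))
    (h : ∀ a b, M a b ∈ ordSub K n N) : Matrix ι ι' (OrdRing K n N) :=
  fun a b => supportedEquivMvPolynomial _ ⟨M a b, h a b⟩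

theorem ordVal_restrictMat {ι ι' : Type*} {N : ℕ} (M : Matrix ι ι' (DiffPoly K n))
    (h : ∀ a b, M a b ∈ ordSub K n N) (a : ι) (b : ι') :
    ordVal K n N (restrictMat M h a b) = M a b := by
  have key : ∀ y : OrdRing K n N,
      (((supportedEquivMvPolynomial {v : Fin n × ℕ | v.2 ≤ N}).symm y : ordSub K n N) :
        DiffPoly K n) = ordVal K n N y := fun y => by
    simp [supportedEquivMvPolynomial, ordVal]
  rw [← key, restrictMat, AlgEquiv.symm_apply_apply]

/-! ### Local rings and the ideals `Δ_m` -/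

section Contr

variable (p : Ideal (DiffPoly K n))

/-- The prime ideal `A_N ∩ p` of `A_N`. -/
def contr (N : ℕ) : Ideal (OrdRing K n N) := p.comap (ordVal K n N)

theorem contr_comap {M N : ℕ} (h : M ≤ N) :
    contr p M = (contr p N).comap (ordIncl K n h : OrdRing K n M →+* OrdRing K n N) := by
  ext a
  simp [contr, Ideal.mem_comap, ordVal_ordIncl]

end Contr

variable (p : Ideal (DiffPoly K n)) [p.IsPrime]

instance (N : ℕ) : (contr p N).IsPrime := Ideal.comap_isPrime _ _

/-- The local ring `B_N`, the localization of `A_N` at `A_N ∩ p`. -/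
abbrev LocRing (N : ℕ) : Type _ := Localization.AtPrime (contr p N)

/-- The inclusion `B_M → B_N` for `M ≤ N`. -/
def locIncl {M N : ℕ} (h : M ≤ N) : LocRing p M →+* LocRing p N :=
  Localization.localRingHom (contr p M) (contr p N)
    (ordIncl K n h : OrdRing K n M →+* OrdRing K n N) (contr_comap p h)

/-- The ideal of `B_N` generated by the `f_j^{(l)}`, `l < m`. It is used for `m - 1 + e = N`
(where all these polynomials lie in `A_N`), and is then the ideal `Δ_m ⊆ B_{m-1+e}`. -/
def deltaIdeal (N m : ℕ) : Ideal (LocRing p N) :=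
  Ideal.span {x | ∃ a : OrdRing K n N,
    (∃ l < m, ∃ j, ordVal K n N a = transform σ l (f j)) ∧
      x = algebraMap (OrdRing K n N) (LocRing p N) a}

/-- The ideal `Δ_{i-e+1+k}` of `B_{i+k}`, for `i ≥ e - 1`. -/
abbrev Delta (i k : ℕ) : Ideal (LocRing p (i + k)) :=
  deltaIdeal σ f p (i + k) (i + 1 - sysOrder f + k)

/-- The endomorphism of `K{Y}_p` induced by `σ`, for a reflexive prime difference ideal `p`. -/
def locShift (hp : IsDiffPrime (shift σ) p) :
    Localization.AtPrime p →+* Localization.AtPrime p :=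
  Localization.localRingHom p p (shift σ) hp.eq_comap

/-- The difference ideal `Δ` generated by `F` in `K{Y}_p`. -/
def deltaTop (hp : IsDiffPrime (shift σ) p) : Ideal (Localization.AtPrime p) :=
  diffSpan (locShift σ p hp)
    (Set.range fun j => algebraMap (DiffPoly K n) (Localization.AtPrime p) (f j))

/-- `F` is quasi-regular at `p`: for every `k ≥ 1` the Jacobian matrix of `f₁^{[k-1]}, …, f_r^{[k-1]}`
with respect to `Y^{[k-1+e]}` has full row rank over the domain `A_{k-1+e} ⧸ (A_{k-1+e} ∩ p)`
(the rank being computed in its field of fractions), and `Δ` is reflexive. -/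
structure IsQuasiRegularAt (hp : IsDiffPrime (shift σ) p) : Prop where
  full_rank : ∀ k : ℕ, 1 ≤ k →
    ((restrictMat (fullJac σ f k) (fullJac_mem σ f k)).map
      (algebraMap (OrdRing K n (k - 1 + sysOrder f))
        (ResFrac (contr p (k - 1 + sysOrder f))))).rank = k * r
  reflexive : IsReflexive (locShift σ p hp) (deltaTop σ f p hp)

/-- The rank of `J_{k,i}` over the residue field of `Δ_{i-e+1+k+s}` (an ideal of `B_{i+k+s}`). -/
def deltaRank (k i s : ℕ) (hi : sysOrder f ≤ i + 1) : ℕ :=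
  ((restrictMat (N := i + (k + s)) (pseudoJac σ f k i)
      (pseudoJac_mem σ f hi (by omega))).map
    ((algebraMap (LocRing p (i + (k + s))) (ResFrac (Delta σ f p i (k + s)))).comp
      (algebraMap (OrdRing K n (i + (k + s))) (LocRing p (i + (k + s)))))).rank

/-- The rank of `J_{k,i}` over the residue field of `Δ_{i-e+1+k+s}` does not depend on `s`. -/
def RankStable : Prop :=
  ∀ (k i : ℕ) (hi : sysOrder f ≤ i + 1) (s : ℕ),
    deltaRank σ f p k i s hi = deltaRank σ f p k i 0 hi

/-- `μ_{k,i}`, the dimension of the kernel of the transpose of `J_{k,i}` over the residue field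
`κ` of `p`. -/
def muAt (k i : ℕ) : ℕ :=
  Module.finrank (ResFrac p) (LinearMap.ker
    ((pseudoJac σ f k i).map (algebraMap (DiffPoly K n) (ResFrac p))).transpose.mulVecLin)

/-- `μ_k`, the common value of the `μ_{k,i}`, `i ≥ e - 1`, read off at `i = e - 1`. -/
def mu (k : ℕ) : ℕ := muAt σ f p k (sysOrder f - 1)

end DiffPoly

end DiffAlg

end

/-! Each local ring $B_N$ is regular. Full row rank of the Jacobian matrix makes the classes of the
$f_j^{(l)}$ in the cotangent space linearly independent, so $B_N/\Delta_m$ (with $m+e=N+1$) is again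
regular, hence a domain, and $\Delta_m$ is prime (`deltaIdeal_isPrime`).

In characteristic $0$, $\operatorname{trdeg}_E L=\dim_L\operatorname{Der}_E(L,L)$. If
$L=\operatorname{Frac}(B_N/\Delta_m)$ and $E$ is generated by all variables outside a chosen set,
such a derivation is determined by its values on the chosen variables, and the admissible values are
the kernel of the Jacobian matrix in these variables
(`MvPolynomial.exists_trdeg_add_rank_jacobian`). Choosing all variables gives
$\operatorname{trdeg}_K L=(N+1)n-mr$. With $N=i+k$, choosing those of order above $i$ gives
$kn-\operatorname{rank}J_{k,i}$, since the equations of order at most $i$ contribute zero rows.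

It remains to compare the rank of $J_{k,i}$ over $L$ with its rank $kr-\mu_{k,i}$ over $\kappa$
(`deltaRank_eq_rank`). The ideal $\Delta$ is the union of the primes $\Delta_m$ and is reflexive, so
its contraction to $K\{Y\}$ is a $\sigma$-prime between $[F]$ and $\mathfrak p$; by minimality it
equals $\mathfrak p$. A minor vanishing in $\kappa$ thus already vanishes modulo some $\Delta_m$,
and rank stability brings this back to $s=0$. Finally $J_{k,i+1}=\sigma(J_{k,i})$ and $\sigma$
embeds $\kappa$ in itself, so $\mu_{k,i}$ does not depend on $i$. Additivity of transcendence degree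
gives the second formula. -/

/-! ### Ranks, minors and specialization of matrices. -/

theorem Matrix.exists_submatrix_linearIndependent_row {L m n : Type*} [Field L] [Fintype m]
    [Fintype n] (M : Matrix m n L) :
    ∃ a : Fin M.rank → m, LinearIndependent L (M.submatrix a id).row := by
  have h := M.rank_eq_finrank_span_row
  obtain ⟨g, hg, -, hli⟩ := Submodule.exists_fun_fin_finrank_span_eq L (Set.range M.row)
  choose a ha using hg
  refine ⟨fun i => a (Fin.cast h i), ?_⟩
  have : (M.submatrix (fun i => a (Fin.cast h i)) id).row = g ∘ Fin.cast h := by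
    funext i
    exact ha _
  rw [this]
  exact hli.comp _ (Fin.cast_injective h)

theorem Matrix.exists_det_submatrix_ne_zero {L m n : Type*} [Field L] [Fintype m] [Fintype n]
    (M : Matrix m n L) :
    ∃ (a : Fin M.rank → m) (b : Fin M.rank → n), (M.submatrix a b).det ≠ 0 := by
  obtain ⟨a, ha⟩ := M.exists_submatrix_linearIndependent_row
  have hr : (M.submatrix a id).transpose.rank = M.rank := by
    rw [Matrix.rank_transpose, LinearIndependent.rank_matrix ha, Fintype.card_fin]
  obtain ⟨b, hb⟩ := (M.submatrix a id).transpose.exists_submatrix_linearIndependent_row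
  refine ⟨a, fun i => b (Fin.cast hr.symm i), fun hdet => ?_⟩
  have hb' : LinearIndependent L (M.submatrix a fun i => b (Fin.cast hr.symm i)).transpose.row :=
    hb.comp _ (Fin.cast_injective hr.symm)
  have := Matrix.linearIndependent_rows_iff_isUnit.1 hb'
  rw [Matrix.isUnit_iff_isUnit_det, Matrix.det_transpose, hdet] at this
  exact not_isUnit_zero this

theorem Matrix.card_le_rank_of_det_submatrix_ne_zero {L m n l : Type*} [Field L] [Fintype m]
    [Fintype n] [Fintype l] [DecidableEq l] (M : Matrix m n L) (a : l → m) (b : l → n)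
    (h : (M.submatrix a b).det ≠ 0) : Fintype.card l ≤ M.rank := by
  rw [← Matrix.rank_of_det_ne_zero h]
  exact Matrix.rank_submatrix_le _ _ _

/-- The rank of a matrix does not increase under specialization. -/
theorem Matrix.rank_map_le_of_specialization {R L L' m n : Type*} [CommRing R] [Field L] [Field L']
    [Fintype m] [Fintype n] (φ : R →+* L) (ψ : R →+* L') (h : ∀ x, φ x = 0 → ψ x = 0)
    (M : Matrix m n R) : (M.map ψ).rank ≤ (M.map φ).rank := by
  obtain ⟨a, b, hab⟩ := (M.map ψ).exists_det_submatrix_ne_zero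
  rw [← Fintype.card_fin (M.map ψ).rank]
  refine (M.map φ).card_le_rank_of_det_submatrix_ne_zero a b fun h0 => hab ?_
  rw [Matrix.submatrix_map, ← RingHom.mapMatrix_apply, ← RingHom.map_det] at h0 ⊢
  exact h _ h0

/-! ### Regular local rings: quotients by part of a system of parameters, and integrality. -/

section RegularLocalRings

open IsLocalRing

/-- Lifts of a basis of the cotangent space modulo the span of the `x i`, together with the `x i`,
generate the maximal ideal by Nakayama. In the quotient the `x i` vanish, so the lifts alone
generate. -/
theorem IsLocalRing.spanFinrank_maximalIdeal_quotient_add_le {R : Type*} [CommRing R]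
    [IsLocalRing R] [IsNoetherianRing R] {ι : Type*} [Fintype ι] (x : ι → maximalIdeal R)
    (hx : LinearIndependent (ResidueField R)
      fun i => ((maximalIdeal R).toCotangent (x i) : CotangentSpace R))
    {I : Ideal R} (hI : I = Ideal.span (Set.range fun i => (x i : R))) [IsLocalRing (R ⧸ I)] :
    (maximalIdeal (R ⧸ I)).spanFinrank + Fintype.card ι ≤ (maximalIdeal R).spanFinrank := by
  let W : Submodule (ResidueField R) (CotangentSpace R) := Submodule.span (ResidueField R)
    (Set.range fun i => ((maximalIdeal R).toCotangent (x i) : CotangentSpace R))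
  have hWr : Module.finrank (ResidueField R) W = Fintype.card ι := finrank_span_eq_card hx
  have hq := W.finrank_quotient_add_finrank
  let b := Module.finBasis (ResidueField R) (CotangentSpace R ⧸ W)
  choose w hw using fun i => W.mkQ_surjective (b i)
  choose g hg using fun i => (maximalIdeal R).toCotangent_surjective (w i)
  have htop : Submodule.span (ResidueField R)
      ((maximalIdeal R).toCotangent '' (Set.range x ∪ Set.range g)) = ⊤ := by
    rw [Set.image_union, Submodule.span_union, ← Set.range_comp, ← Set.range_comp]
    have h1 : Set.range ((maximalIdeal R).toCotangent ∘ g) = Set.range w :=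
      congrArg Set.range (funext hg)
    rw [h1]
    change W ⊔ _ = ⊤
    rw [← Submodule.map_mkQ_eq_top, Submodule.map_span, ← Set.range_comp]
    have h2 : W.mkQ ∘ w = b := funext hw
    rw [h2, b.span_eq]
  rw [CotangentSpace.span_image_eq_top_iff] at htop
  have hm : maximalIdeal R = Ideal.span (Set.range (fun i => (x i : R)) ∪
      Set.range (fun i => (g i : R))) := by
    have := congrArg (Submodule.map (maximalIdeal R).subtype) htop
    rw [Submodule.map_span, Submodule.map_top, Submodule.range_subtype, Set.image_union,
      ← Set.range_comp, ← Set.range_comp] at this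
    exact this.symm
  have hm' : maximalIdeal (R ⧸ I) =
      Ideal.span (Set.range fun i => Ideal.Quotient.mk I (g i : R)) := by
    have h1 : (maximalIdeal R).map (Ideal.Quotient.mk I) = maximalIdeal (R ⧸ I) := by
      have := IsLocalRing.map_maximalIdeal_of_surjective (Ideal.Quotient.mk I)
        Ideal.Quotient.mk_surjective
      exact this
    have h3 := congrArg (Ideal.map (Ideal.Quotient.mk I)) hm
    rw [← h1, h3, Ideal.map_span, Set.image_union, Ideal.span_union, ← Set.range_comp,
      ← Set.range_comp]
    refine sup_eq_right.2 (Ideal.span_le.2 ?_)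
    rintro _ ⟨i, rfl⟩
    have : Ideal.Quotient.mk I (x i : R) = 0 :=
      Ideal.Quotient.eq_zero_iff_mem.2 (hI ▸ Ideal.subset_span ⟨i, rfl⟩)
    simp [this]
  have hle : (maximalIdeal (R ⧸ I)).spanFinrank ≤
      Module.finrank (ResidueField R) (CotangentSpace R ⧸ W) := by
    rw [hm']
    refine (Submodule.spanFinrank_span_le_ncard_of_finite (Set.finite_range _)).trans ?_
    rw [← Set.image_univ]
    refine (Set.ncard_image_le Set.finite_univ).trans ?_
    simp
  have hd : (maximalIdeal R).spanFinrank =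
      Module.finrank (ResidueField R) (CotangentSpace R ⧸ W) + Fintype.card ι := by
    rw [IsLocalRing.spanFinrank_maximalIdeal_eq_finrank_cotangentSpace, ← hWr]
    exact hq.symm
  omega

theorem IsLocalRing.isLocalRing_quotient_span {R : Type*} [CommRing R]
    [IsLocalRing R] {ι : Type*} (x : ι → maximalIdeal R) :
    IsLocalRing (R ⧸ Ideal.span (Set.range fun i => (x i : R))) := by
  have : Nontrivial (R ⧸ Ideal.span (Set.range fun i => (x i : R))) := by
    refine Ideal.Quotient.nontrivial_iff.2 fun h => (maximalIdeal.isMaximal R).ne_top ?_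
    rw [eq_top_iff, ← h, Ideal.span_le]
    rintro _ ⟨i, rfl⟩
    exact (x i).2
  exact IsLocalRing.of_surjective' _ Ideal.Quotient.mk_surjective

/-- Passing to the quotient lowers the embedding dimension by at least the number of the `x i` and
the Krull dimension by at most that number, so the embedding dimension cannot exceed the Krull
dimension. -/
theorem IsRegularLocalRing.quotient_span_of_linearIndependent {R : Type*} [CommRing R]
    [IsRegularLocalRing R] {ι : Type*} [Fintype ι] (x : ι → maximalIdeal R)
    (hx : LinearIndependent (ResidueField R)
      fun i => ((maximalIdeal R).toCotangent (x i) : CotangentSpace R))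
    {I : Ideal R} (hI : I = Ideal.span (Set.range fun i => (x i : R))) :
    IsRegularLocalRing (R ⧸ I) := by
  have : IsLocalRing (R ⧸ I) := hI ▸ IsLocalRing.isLocalRing_quotient_span x
  have h1 := IsLocalRing.spanFinrank_maximalIdeal_quotient_add_le x hx hI
  have h2 : ringKrullDim R ≤ ringKrullDim (R ⧸ I) + I.spanFinrank := by
    refine ringKrullDim_le_ringKrullDim_quotient_add_spanFinrank I ?_
    rw [IsLocalRing.ringJacobson_eq_maximalIdeal, hI, Ideal.span_le]
    rintro _ ⟨i, rfl⟩
    exact (x i).2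
  have h3 : I.spanFinrank ≤ Fintype.card ι := by
    rw [hI]
    refine (Submodule.spanFinrank_span_le_ncard_of_finite (Set.finite_range _)).trans ?_
    rw [← Set.image_univ]
    refine (Set.ncard_image_le Set.finite_univ).trans ?_
    simp
  refine IsRegularLocalRing.of_spanFinrank_maximalIdeal_le _ ?_
  rw [← IsRegularLocalRing.spanFinrank_maximalIdeal] at h2
  obtain ⟨e, he⟩ : ∃ e : ℕ, ringKrullDim (R ⧸ I) = e := by
    have h4 := ringKrullDim_le_spanFinrank_maximalIdeal (R ⧸ I)
    have h5 : ringKrullDim (R ⧸ I) ≠ ⊥ := ringKrullDim_ne_bot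
    generalize ringKrullDim (R ⧸ I) = t at h4 h5
    induction t with
    | bot => exact absurd rfl h5
    | coe t =>
      induction t with
      | top => exact absurd (WithBot.coe_le_coe.1 h4) (by simp)
      | coe t => exact ⟨t, rfl⟩
  rw [he] at h2 ⊢
  norm_cast at h2 ⊢
  omega

/-- Induction on the embedding dimension. Prime avoidance gives a parameter $x\notin\mathfrak m^2$
outside every minimal prime. By induction $(x)$ is prime, so it contains a minimal prime $q$; as
$x\notin q$, $q=xq$, and Nakayama gives $q=0$. -/
theorem IsRegularLocalRing.isDomain (R : Type*) [CommRing R] [IsRegularLocalRing R] :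
    IsDomain R := by
  suffices H : ∀ (d : ℕ) (R : Type _) [CommRing R] [IsRegularLocalRing R],
      (maximalIdeal R).spanFinrank ≤ d → IsDomain R from H _ R le_rfl
  intro d
  induction d with
  | zero =>
    intro R _ _ h
    have h0 : maximalIdeal R = ⊥ := (Submodule.spanFinrank_eq_zero_iff_eq_bot
      (IsNoetherian.noetherian _)).1 (Nat.le_zero.1 h)
    exact (IsLocalRing.isField_iff_maximalIdeal_eq.2 h0).isDomain
  | succ d ih =>
    intro R _ _ h
    by_cases h0 : maximalIdeal R = ⊥
    · exact (IsLocalRing.isField_iff_maximalIdeal_eq.2 h0).isDomain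
    have hfg : (maximalIdeal R).FG := IsNoetherian.noetherian _
    have hjac : maximalIdeal R ≤ Ideal.jacobson ⊥ :=
      (IsLocalRing.jacobson_eq_maximalIdeal _ bot_ne_top).ge
    have hfin := minimalPrimes.finite_of_isNoetherianRing R
    have hdim : ringKrullDim R ≠ 0 := by
      rw [← IsRegularLocalRing.spanFinrank_maximalIdeal]
      intro h'
      have : (maximalIdeal R).spanFinrank = 0 := by exact_mod_cast h'
      exact h0 ((Submodule.spanFinrank_eq_zero_iff_eq_bot hfg).1 this)
    obtain ⟨x, hxm, hx2, hxq⟩ : ∃ x ∈ maximalIdeal R, x ∉ maximalIdeal R ^ 2 ∧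
        ∀ q ∈ minimalPrimes R, x ∉ q := by
      by_contra! hcon
      have hsub : ((maximalIdeal R : Ideal R) : Set R) ⊆
          ⋃ i ∈ (↑(insert (maximalIdeal R ^ 2) hfin.toFinset) : Set (Ideal R)), (i : Set R) := by
        intro y hy
        by_cases hy2 : y ∈ maximalIdeal R ^ 2
        · exact Set.mem_biUnion (by simp) hy2
        · obtain ⟨q, hq, hyq⟩ := hcon y hy hy2
          exact Set.mem_biUnion (by simp [hq]) hyq
      -- Prime avoidance tolerates two members that are not prime; the square of the maximal ideal
      -- fills both places.
      rw [Ideal.subset_union_prime (f := fun i : Ideal R => i) (maximalIdeal R ^ 2)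
        (maximalIdeal R ^ 2)] at hsub
      · obtain ⟨q, hq, hle⟩ := hsub
        rw [Finset.mem_insert, Set.Finite.mem_toFinset] at hq
        rcases hq with rfl | hq
        · refine h0 (Submodule.eq_bot_of_le_smul_of_le_jacobson_bot _ _ hfg ?_ hjac)
          rw [smul_eq_mul, ← sq]
          exact hle
        · apply hdim
          have := hq.1.1
          have hqm : q = maximalIdeal R := le_antisymm (le_maximalIdeal this.ne_top) hle
          rw [← maximalIdeal_height_eq_ringKrullDim, ← hqm]
          rw [Ideal.height_eq_zero_iff.2 hq]
          rfl
      · intro q hq hq1 _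
        rw [Finset.mem_insert, Set.Finite.mem_toFinset] at hq
        exact (hq.resolve_left hq1).1.1
    let X : Unit → maximalIdeal R := fun _ => ⟨x, hxm⟩
    have hX : LinearIndependent (ResidueField R)
        fun i => ((maximalIdeal R).toCotangent (X i) : CotangentSpace R) := by
      have : IsDomain (ResidueField R) := Field.isDomain
      refine LinearIndependent.of_subsingleton (M := CotangentSpace R) () fun h' => hx2 ?_
      exact (Ideal.toCotangent_eq_zero _ _).1 h'
    have hspan : Ideal.span {x} = Ideal.span (Set.range fun i => (X i : R)) := by
      simp [X]
    have hreg := IsRegularLocalRing.quotient_span_of_linearIndependent X hX hspan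
    have hr := IsLocalRing.spanFinrank_maximalIdeal_quotient_add_le X hX hspan
    have hdom := ih (R ⧸ Ideal.span {x}) (by rw [Fintype.card_unit] at hr; omega)
    rw [Ideal.Quotient.isDomain_iff_prime] at hdom
    obtain ⟨q, hq, hqx⟩ := Ideal.exists_minimalPrimes_le (I := ⊥) (J := Ideal.span {x}) bot_le
    have hqp := hq.1.1
    have hxq' := hxq q hq
    have hqbot : q = ⊥ := by
      refine Submodule.eq_bot_of_le_smul_of_le_jacobson_bot (Ideal.span {x}) q
        (IsNoetherian.noetherian _) ?_ ?_
      · intro y hy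
        obtain ⟨a, rfl⟩ := Ideal.mem_span_singleton'.1 (hqx hy)
        have ha := (hqp.mem_or_mem hy).resolve_right hxq'
        rw [smul_eq_mul, mul_comm a]
        exact Ideal.mul_mem_mul (Ideal.mem_span_singleton_self x) ha
      · exact ((Ideal.span_singleton_le_iff_mem _).2 hxm).trans hjac
    rw [hqbot] at hqp
    exact IsDomain.of_bot_isPrime R

/-! ### Differentials, dual numbers and the Jacobian criterion. -/

/-- For a transcendence basis $s$, $L$ is formally étale over $E[s]$: a localization followed by an
algebraic extension, separable in characteristic $0$. Hence the differentials of the elements of $s$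
form a basis. -/
theorem KaehlerDifferential.rank_eq_trdeg (E L : Type*) [Field E] [Field L] [Algebra E L]
    [CharZero E] : Module.rank L (Ω[L⁄E]) = Algebra.trdeg E L := by
  obtain ⟨s, hs⟩ := exists_isTranscendenceBasis E L
  let P := MvPolynomial s E
  let : Algebra P L := (MvPolynomial.aeval ((↑) : s → L)).toAlgebra
  have : IsScalarTower E P L := IsScalarTower.of_algebraMap_eq fun x =>
    ((MvPolynomial.aeval ((↑) : s → L)).commutes x).symm
  have hinj : Function.Injective (algebraMap P L) := hs.1
  have : FaithfulSMul P L := (faithfulSMul_iff_algebraMap_injective P L).2 hinj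
  let : Algebra (FractionRing P) L := FractionRing.liftAlgebra P L
  have : Algebra.IsAlgebraic P L := by
    have h := hs.isAlgebraic
    refine ⟨fun x => ?_⟩
    obtain ⟨g, hg0, hg⟩ := h.isAlgebraic x
    let e := hs.1.aevalEquiv
    refine ⟨g.map (e.symm : _ →+* P), ?_, ?_⟩
    · exact (Polynomial.map_ne_zero_iff e.symm.injective).2 hg0
    · rw [← hg, Polynomial.aeval_def, Polynomial.aeval_def, Polynomial.eval₂_map]
      congr 1
      ext y
      obtain ⟨y, rfl⟩ := e.surjective y
      simp [e, RingHom.algebraMap_toAlgebra]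
  have : Algebra.IsAlgebraic (FractionRing P) L := IsFractionRing.comap_isAlgebraic_iff.1 ‹_›
  have : CharZero (FractionRing P) := charZero_of_injective_algebraMap
    (algebraMap E (FractionRing P)).injective
  have : Algebra.FormallyEtale (FractionRing P) L := Algebra.FormallyEtale.of_isSeparable _ _
  have : Algebra.FormallyEtale P (FractionRing P) :=
    Algebra.FormallyEtale.of_isLocalization (nonZeroDivisors P)
  have : Algebra.FormallyEtale P L := Algebra.FormallyEtale.comp P (FractionRing P) L
  let b := ((KaehlerDifferential.mvPolynomialBasis E s).baseChange L).map
    (KaehlerDifferential.tensorKaehlerEquivOfFormallyEtale E P L)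
  rw [← hs.cardinalMk_eq_trdeg, b.mk_eq_rank'']

/-- The homomorphism to the dual numbers lifting `φ` whose infinitesimal part is the derivation
`∑ v, w v ∂/∂v`. -/
noncomputable def MvPolynomial.dualHom {k ι L : Type*} [CommRing k] [Fintype ι] [CommRing L]
    (φ : MvPolynomial ι k →+* L) (w : ι → L) : MvPolynomial ι k →+* DualNumber L where
  toFun a := TrivSqZeroExt.inl (φ a) + TrivSqZeroExt.inr (∑ v, φ (pderiv v a) * w v)
  map_one' := by ext <;> simp
  map_zero' := by ext <;> simp
  map_add' a b := by ext <;> simp [add_mul, Finset.sum_add_distrib]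
  map_mul' a b := by
    ext
    · simp
    · simp only [TrivSqZeroExt.snd_add, TrivSqZeroExt.snd_inl, TrivSqZeroExt.snd_inr, zero_add,
        TrivSqZeroExt.snd_mul, TrivSqZeroExt.fst_add, TrivSqZeroExt.fst_inl,
        TrivSqZeroExt.fst_inr, add_zero, smul_eq_mul, MulOpposite.smul_eq_mul_unop,
        MulOpposite.unop_op, Finset.mul_sum, Finset.sum_mul, ← Finset.sum_add_distrib]
      refine Finset.sum_congr rfl fun v _ => ?_
      rw [MvPolynomial.pderiv_mul, map_add, map_mul, map_mul]
      ring

theorem MvPolynomial.fst_dualHom {k ι L : Type*} [CommRing k] [Fintype ι] [CommRing L]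
    (φ : MvPolynomial ι k →+* L) (w : ι → L) (a : MvPolynomial ι k) :
    (dualHom φ w a).fst = φ a := by
  simp [dualHom]

theorem MvPolynomial.snd_dualHom {k ι L : Type*} [CommRing k] [Fintype ι] [CommRing L]
    (φ : MvPolynomial ι k →+* L) (w : ι → L) (a : MvPolynomial ι k) :
    (dualHom φ w a).snd = ∑ v, φ (pderiv v a) * w v := by
  simp [dualHom]

/-- The Jacobian criterion: polynomials with a Jacobian matrix of full row rank at a prime `q`
generate a prime ideal of the local ring at `q`. -/
theorem MvPolynomial.isPrime_span_of_linearIndependent_jacobian {k ι τ L : Type*} [Field k]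
    [Fintype ι] [Fintype τ] [Field L] (q : Ideal (MvPolynomial ι k)) [q.IsPrime]
    (f : τ → MvPolynomial ι k) (hf : ∀ j, f j ∈ q) (φ : MvPolynomial ι k →+* L)
    (hφ : RingHom.ker φ = q) (hJ : LinearIndependent L fun j v => φ (pderiv v (f j))) :
    (Ideal.span (Set.range fun j =>
      algebraMap (MvPolynomial ι k) (Localization.AtPrime q) (f j))).IsPrime := by
  classical
  let A := MvPolynomial ι k
  let B := Localization.AtPrime q
  have hunit : ∀ y : q.primeCompl, IsUnit (φ y) := fun y =>
    isUnit_iff_ne_zero.2 fun h => y.2 (hφ.le (RingHom.mem_ker.2 h))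
  let φ' : B →+* L := IsLocalization.lift hunit
  have hφ' : ∀ a : A, φ' (algebraMap A B a) = φ a := fun a => IsLocalization.lift_eq hunit a
  have hm : maximalIdeal B ≤ RingHom.ker φ' := by
    rw [← Localization.AtPrime.map_eq_maximalIdeal, Ideal.map_le_iff_le_comap]
    intro a ha
    rw [Ideal.mem_comap, RingHom.mem_ker, hφ', ← RingHom.mem_ker, hφ]
    exact ha
  have hunit' : ∀ w (y : q.primeCompl), IsUnit (dualHom φ w y) := fun w y => by
    rw [TrivSqZeroExt.isUnit_iff_isUnit_fst, fst_dualHom]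
    exact hunit y
  -- These homomorphisms send the maximal ideal into the infinitesimals, hence kill its square.
  -- Applied to a relation among the classes of the `f j`, they return a relation among the rows of
  -- the Jacobian matrix.
  let ψ (w : ι → L) : B →+* DualNumber L := IsLocalization.lift (hunit' w)
  have hψ : ∀ w (a : A), ψ w (algebraMap A B a) = dualHom φ w a :=
    fun w a => IsLocalization.lift_eq (hunit' w) a
  have hψ1 : ∀ w (b : B), (ψ w b).fst = φ' b := by
    intro w b
    have : ((TrivSqZeroExt.fstHom L L L : _ →+* L).comp (ψ w)) = φ' := by
      refine IsLocalization.ringHom_ext q.primeCompl (RingHom.ext fun a => ?_)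
      simp only [RingHom.comp_apply]
      rw [hφ', hψ]
      exact fst_dualHom φ w a
    exact congrArg (fun g : B →+* L => g b) this
  have hψ2 : ∀ w (b : B), b ∈ maximalIdeal B ^ 2 → ψ w b = 0 := by
    intro w b hb
    have hle : maximalIdeal B ^ 2 ≤ RingHom.ker (ψ w) := by
      rw [sq, Ideal.mul_le]
      intro r hr s hs
      have hr' : (ψ w r).fst = 0 := (hψ1 w r).trans (hm hr)
      have hs' : (ψ w s).fst = 0 := (hψ1 w s).trans (hm hs)
      rw [RingHom.mem_ker, map_mul]
      ext <;> simp [hr', hs']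
    exact hle hb
  have hx : ∀ j, algebraMap A B (f j) ∈ maximalIdeal B := fun j => by
    rw [← Localization.AtPrime.map_eq_maximalIdeal]
    exact Ideal.mem_map_of_mem _ (hf j)
  let x : τ → maximalIdeal B := fun j => ⟨algebraMap A B (f j), hx j⟩
  have hli : LinearIndependent (ResidueField B)
      fun j => ((maximalIdeal B).toCotangent (x j) : CotangentSpace B) := by
    rw [Fintype.linearIndependent_iff]
    intro g hg
    choose c hc using fun j => IsLocalRing.residue_surjective (g j)
    have h1 : (maximalIdeal B).toCotangent (∑ j, c j • x j) = 0 := by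
      rw [map_sum, ← hg]
      refine Finset.sum_congr rfl fun j _ => ?_
      rw [map_smul, ← hc]
      rfl
    rw [Ideal.toCotangent_eq_zero] at h1
    have h2 : ∀ v, ∑ j, φ' (c j) * φ (pderiv v (f j)) = 0 := by
      intro v
      -- A unit vector as direction picks out the column of `v`.
      have h3 := congrArg TrivSqZeroExt.snd (hψ2 (Pi.single v 1) _ h1)
      simp only [AddSubmonoidClass.coe_finsetSum, map_sum, Submodule.coe_smul, smul_eq_mul,
        map_mul, x, hψ, TrivSqZeroExt.snd_zero] at h3
      rw [← h3]
      have h4 : ∀ y : τ → DualNumber L, (∑ j, y j).snd = ∑ j, (y j).snd := fun y =>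
        map_sum (TrivSqZeroExt.sndHom L L) y _
      rw [h4]
      refine Finset.sum_congr rfl fun j _ => ?_
      have h5 : φ (f j) = 0 := by rw [← RingHom.mem_ker, hφ]; exact hf j
      simp [fst_dualHom, snd_dualHom, hψ1, h5, Pi.single_apply]
    have h6 := Fintype.linearIndependent_iff.1 hJ (fun j => φ' (c j)) (by
      ext v
      simpa using h2 v)
    intro j
    rw [← hc, IsLocalRing.residue_eq_zero_iff, IsLocalRing.mem_maximalIdeal, mem_nonunits_iff]
    exact fun hu => (hu.map φ').ne_zero (h6 j)
  have : IsRegularLocalRing B := IsRegularRing.isRegularLocalRing_localization q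
  have hreg := IsRegularLocalRing.quotient_span_of_linearIndependent x hli
    (I := Ideal.span (Set.range fun j => algebraMap A B (f j))) rfl
  have hdom := @IsRegularLocalRing.isDomain _ _ hreg
  rwa [Ideal.Quotient.isDomain_iff_prime] at hdom

end RegularLocalRings

/-! ### Derivations of function fields and transcendence degree. -/

/-- If a derivation of the field `L` kills the constants and the variables outside the image of
`c`, its values on polynomial expressions are given by the chain rule. -/
theorem MvPolynomial.derivation_apply_eq_sum {k ι κ E L : Type*} [Field k] [Fintype κ]
    [Field E] [Field L] [Algebra E L] (φ : MvPolynomial ι k →+* L) {c : κ → ι}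
    (hc : Function.Injective c)
    (hE : ∀ a ∈ supported k (Set.range c)ᶜ, φ a ∈ (algebraMap E L).range)
    (D : Derivation E L L) (a : MvPolynomial ι k) :
    D (φ a) = ∑ v, φ (pderiv (c v) a) * D (φ (X (c v))) := by
  classical
  have hD : ∀ a ∈ supported k (Set.range c)ᶜ, D (φ a) = 0 := fun a ha => by
    obtain ⟨y, hy⟩ := hE a ha
    rw [← hy, D.map_algebraMap]
  induction a using MvPolynomial.induction_on with
  | C x =>
    have h0 : D (φ (C x)) = 0 := hD _ (Subalgebra.algebraMap_mem _ x)
    simp [h0]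
  | add p q hp hq => simp [hp, hq, add_mul, Finset.sum_add_distrib]
  | mul_X p i hp =>
    rw [map_mul, D.leibniz, hp]
    simp only [pderiv_mul, map_add, map_mul, add_mul, Finset.sum_add_distrib, smul_eq_mul]
    rw [add_comm]
    congr 1
    · rw [Finset.mul_sum]
      exact Finset.sum_congr rfl fun v _ => by ring
    · by_cases hi : i ∈ Set.range c
      · obtain ⟨v, rfl⟩ := hi
        rw [Finset.sum_eq_single v]
        · simp
        · intro u _ hu
          rw [pderiv_X_of_ne (hc.ne hu.symm)]
          simp
        · simp
      · have hX : (X i : MvPolynomial ι k) ∈ supported k (Set.range c)ᶜ :=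
          Algebra.subset_adjoin ⟨i, hi, rfl⟩
        rw [hD _ hX, mul_zero]
        refine (Finset.sum_eq_zero fun v _ => ?_).symm
        rw [pderiv_X_of_ne fun h => hi ⟨v, h.symm⟩]
        simp

/-- Extension of `MvPolynomial.dualHom φ w` to the field of fractions `L` of the image of `φ`. -/
theorem MvPolynomial.exists_dualHom_lift {k ι τ L : Type*} [Field k] [Fintype ι] [Field L]
    (φ : MvPolynomial ι k →+* L) (hL : ∀ x : L, ∃ a b, φ b ≠ 0 ∧ x = φ a / φ b)
    (f : τ → MvPolynomial ι k) (hf : ∀ j, φ (f j) = 0)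
    (hker : ∀ g, φ g = 0 → ∃ h, φ h ≠ 0 ∧ h * g ∈ Ideal.span (Set.range f))
    (w : ι → L) (hw : ∀ j, ∑ v, φ (pderiv v (f j)) * w v = 0) :
    ∃ Ψ : L →+* DualNumber L, (∀ a, Ψ (φ a) = dualHom φ w a) ∧ ∀ x, (Ψ x).fst = x := by
  have hu : ∀ h, φ h ≠ 0 → IsUnit (dualHom φ w h) := fun h hh => by
    rw [TrivSqZeroExt.isUnit_iff_isUnit_fst, fst_dualHom]
    exact isUnit_iff_ne_zero.2 hh
  -- The condition `hw` kills the `f j`, and the multiplier `h` supplied by `hker` goes to a unit.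
  -- So the whole kernel of `φ` is killed and the map descends to `L`.
  have hψ : ∀ g, φ g = 0 → dualHom φ w g = 0 := by
    intro g hg
    obtain ⟨h, hh, hs⟩ := hker g hg
    have hle : Ideal.span (Set.range f) ≤ RingHom.ker (dualHom φ w) := by
      rw [Ideal.span_le]
      rintro _ ⟨j, rfl⟩
      rw [SetLike.mem_coe, RingHom.mem_ker]
      ext
      · rw [fst_dualHom, hf]; rfl
      · rw [snd_dualHom, hw]; rfl
    have := hle hs
    rw [RingHom.mem_ker, map_mul] at this
    exact (hu h hh).mul_right_eq_zero.1 this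
  let P := RingHom.ker φ
  have hP : P.IsPrime := RingHom.ker_isPrime φ
  have h1 : ∀ y : P.primeCompl, IsUnit (φ y) := fun y =>
    isUnit_iff_ne_zero.2 fun h => y.2 (RingHom.mem_ker.2 h)
  have h2 : ∀ y : P.primeCompl, IsUnit (dualHom φ w y) := fun y =>
    hu _ fun h => y.2 (RingHom.mem_ker.2 h)
  let φ' : Localization.AtPrime P →+* L := IsLocalization.lift h1
  let ψ' : Localization.AtPrime P →+* DualNumber L := IsLocalization.lift h2
  have hφ' : ∀ a, φ' (algebraMap _ _ a) = φ a := fun a => IsLocalization.lift_eq h1 a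
  have hψ' : ∀ a, ψ' (algebraMap _ _ a) = dualHom φ w a := fun a => IsLocalization.lift_eq h2 a
  have hsurj : Function.Surjective φ' := by
    intro x
    obtain ⟨a, b, hb, rfl⟩ := hL x
    have hbP : b ∈ P.primeCompl := fun h => hb (RingHom.mem_ker.1 h)
    refine ⟨IsLocalization.mk' _ a ⟨b, hbP⟩, ?_⟩
    have hs := congrArg φ' (IsLocalization.mk'_spec (Localization.AtPrime P) a ⟨b, hbP⟩)
    rw [map_mul, hφ', hφ'] at hs
    exact (eq_div_iff hb).2 hs
  have hle : RingHom.ker φ' ≤ RingHom.ker ψ' := by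
    intro x hx
    obtain ⟨⟨a, s⟩, hs⟩ := IsLocalization.surj P.primeCompl x
    rw [RingHom.mem_ker] at hx ⊢
    have h3 := congrArg φ' hs
    rw [map_mul, hx, zero_mul, hφ'] at h3
    have h4 := congrArg ψ' hs
    rw [map_mul, hψ', hψ', hψ a h3.symm] at h4
    exact (h2 s).mul_left_eq_zero.1 h4
  let Ψ := RingHom.liftOfSurjective φ' hsurj ⟨ψ', hle⟩
  have hΨ : ∀ x, Ψ (φ' x) = ψ' x := fun x =>
    RingHom.liftOfRightInverse_comp_apply _ _ _ ⟨ψ', hle⟩ x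
  have hΨφ : ∀ a, Ψ (φ a) = dualHom φ w a := fun a => by rw [← hφ', hΨ, hψ']
  refine ⟨Ψ, hΨφ, fun x => ?_⟩
  obtain ⟨a, b, hb, rfl⟩ := hL x
  have h5 : ((Ψ (φ a / φ b)) * Ψ (φ b)).fst = φ a := by
    rw [← map_mul, div_mul_cancel₀ _ hb, hΨφ, fst_dualHom]
  rw [TrivSqZeroExt.fst_mul, hΨφ, fst_dualHom] at h5
  exact (eq_div_iff hb).2 h5

/-- Transcendence degree and Jacobian rank: `L` is the field of fractions of the image of `φ`,
whose kernel is locally generated by the `f j`, and `E` is the subfield of `L` generated by the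
variables outside the image of `c`. -/
theorem MvPolynomial.exists_trdeg_add_rank_jacobian {k ι τ τ' κ E L : Type*} [Field k]
    [Fintype ι] [Fintype τ'] [Fintype κ] [Field E] [Field L] [CharZero E] [Algebra E L]
    (φ : MvPolynomial ι k →+* L) (hL : ∀ x : L, ∃ a b, φ b ≠ 0 ∧ x = φ a / φ b)
    (f : τ → MvPolynomial ι k) (hf : ∀ j, φ (f j) = 0)
    (hker : ∀ g, φ g = 0 → ∃ h, φ h ≠ 0 ∧ h * g ∈ Ideal.span (Set.range f))
    (c : κ → ι) (hc : Function.Injective c)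
    (hE : ∀ a ∈ supported k (Set.range c)ᶜ, φ a ∈ (algebraMap E L).range)
    (hE' : ∀ x : E, ∃ a ∈ supported k (Set.range c)ᶜ, ∃ b ∈ supported k (Set.range c)ᶜ,
      φ b ≠ 0 ∧ algebraMap E L x = φ a / φ b)
    (M : Matrix τ' κ L)
    (hM : ∀ w : κ → L, M.mulVec w = 0 ↔ ∀ j, ∑ v, φ (pderiv (c v) (f j)) * w v = 0) :
    ∃ t : ℕ, Algebra.trdeg E L = t ∧ t + M.rank = Fintype.card κ := by
  classical
  have hchain := derivation_apply_eq_sum φ hc hE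
  let Θ : Derivation E L L →ₗ[L] (κ → L) :=
    { toFun := fun D v => D (φ (X (c v)))
      map_add' := fun _ _ => rfl
      map_smul' := fun _ _ => rfl }
  have hinj : Function.Injective Θ := by
    refine (injective_iff_map_eq_zero Θ).2 fun D hD => ?_
    have h0 : ∀ a, D (φ a) = 0 := fun a => by
      rw [hchain D a]
      refine Finset.sum_eq_zero fun v _ => ?_
      have : D (φ (X (c v))) = 0 := congrFun hD v
      rw [this, mul_zero]
    ext x
    obtain ⟨a, b, hb, rfl⟩ := hL x
    rw [D.leibniz_div, h0, h0]
    simp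
  -- One inclusion is the chain rule applied to the relations `φ (f j) = 0`. For the other, extend
  -- `w` by zero to all variables and take the infinitesimal part of the lift to dual numbers; the
  -- zero values make it `E`-linear.
  have hrange : LinearMap.range Θ = LinearMap.ker M.mulVecLin := by
    ext w
    rw [LinearMap.mem_ker, Matrix.mulVecLin_apply, hM]
    constructor
    · rintro ⟨D, rfl⟩ j
      rw [← D.map_zero, ← hf j]
      exact (hchain D (f j)).symm
    · intro hw
      obtain ⟨w', hw'_def⟩ : ∃ w' : ι → L, w' = Function.extend c w 0 := ⟨_, rfl⟩
      have hw' : ∀ a, ∑ v, φ (pderiv v a) * w' v = ∑ v, φ (pderiv (c v) a) * w v := by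
        intro a
        rw [hw'_def, ← Finset.sum_subset (Finset.subset_univ (Finset.univ.image c)),
          Finset.sum_image hc.injOn]
        · exact Finset.sum_congr rfl fun v _ => by rw [hc.extend_apply w 0 v]
        · intro v _ hv
          have : ¬ ∃ u, c u = v := fun ⟨u, hu⟩ => hv (by simp [← hu])
          rw [Function.extend_apply' w (0 : ι → L) v this]
          simp
      obtain ⟨Ψ, hΨ, hΨ1⟩ := exists_dualHom_lift φ hL f hf hker w' fun j => (hw' _).trans (hw j)
      have hsnd : ∀ a ∈ supported k (Set.range c)ᶜ, (Ψ (φ a)).snd = 0 := by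
        intro a ha
        rw [hΨ, snd_dualHom, hw']
        refine Finset.sum_eq_zero fun v _ => ?_
        rw [pderiv_eq_zero_of_notMem_vars fun hv => (mem_supported.1 ha hv) ⟨v, rfl⟩]
        simp
      have hE0 : ∀ x : E, (Ψ (algebraMap E L x)).snd = 0 := by
        intro x
        obtain ⟨a, ha, b, hb, hb0, hx⟩ := hE' x
        have h1 : (Ψ (algebraMap E L x) * Ψ (φ b)).snd = 0 := by
          rw [← map_mul, hx, div_mul_cancel₀ _ hb0, hsnd a ha]
        rw [TrivSqZeroExt.snd_mul, hsnd b hb, hΨ1, hΨ1] at h1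
        simpa [hb0] using h1
      let D : Derivation E L L := Derivation.mk'
        { toFun := fun x => (Ψ x).snd
          map_add' := fun x y => by simp
          map_smul' := fun x y => by
            rw [Algebra.smul_def, map_mul, TrivSqZeroExt.snd_mul, hE0, hΨ1]
            simp [Algebra.smul_def] }
        (fun x y => by
          change (Ψ (x * y)).snd = _
          rw [map_mul, TrivSqZeroExt.snd_mul, hΨ1, hΨ1]
          simp [mul_comm])
      refine ⟨D, ?_⟩
      ext v
      change (Ψ (φ (X (c v)))).snd = w v
      rw [hΨ, snd_dualHom, hw', Finset.sum_eq_single v]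
      · simp
      · intro u _ hu
        rw [pderiv_X_of_ne (hc.ne hu.symm)]
        simp
      · simp
  let e := (KaehlerDifferential.linearMapEquivDerivation E L (M := L)).trans
    (LinearEquiv.ofInjective Θ hinj)
  -- Finiteness is known first for the dual, which embeds in `κ → L`, and only then for the
  -- differentials.
  have hfin : Module.Finite L (Module.Dual L (Ω[L⁄E])) := Module.Finite.equiv e.symm
  have hfin' : Module.Finite L (Ω[L⁄E]) := Module.finite_dual_iff L |>.1 hfin
  refine ⟨Module.finrank L (Ω[L⁄E]), ?_, ?_⟩
  · rw [← KaehlerDifferential.rank_eq_trdeg, Module.finrank_eq_rank]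
  · rw [← Subspace.dual_finrank_eq, e.finrank_eq, hrange, add_comm, Matrix.rank,
      LinearMap.finrank_range_add_finrank_ker, Module.finrank_fintype_fun_eq_card]

noncomputable section

namespace DiffAlg

/-! ### Residue fields of primes of localizations -/

section ResidueFields

theorem algebraMap_resFrac_eq_zero_iff {R : Type*} [CommRing R] (P : Ideal R) (x : R) :
    algebraMap R (ResFrac P) x = 0 ↔ x ∈ P := by
  rw [IsScalarTower.algebraMap_apply R (R ⧸ P) (ResFrac P),
    map_eq_zero_iff _ (IsFractionRing.injective (R ⧸ P) (ResFrac P))]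
  exact Ideal.Quotient.eq_zero_iff_mem

theorem resFracMap_algebraMap {R S : Type*} [CommRing R] [CommRing S] (φ : R →+* S) (P : Ideal S)
    (hP : P.IsPrime) (x : R) :
    resFracMap φ P hP (algebraMap R _ x) = algebraMap S _ (φ x) := by
  rw [IsScalarTower.algebraMap_apply R (R ⧸ P.comap φ) (ResFrac (P.comap φ)),
    IsScalarTower.algebraMap_apply S (S ⧸ P) (ResFrac P)]
  rw [resFracMap, IsFractionRing.map, IsLocalization.map_eq]
  rfl

variable {A : Type*} [CommRing A] {q : Ideal A} [q.IsPrime] (P : Ideal (Localization.AtPrime q))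

/-- The homomorphism from `A` to the residue field of an ideal of the local ring `A_q`. -/
abbrev locRes : A →+* ResFrac P :=
  (algebraMap (Localization.AtPrime q) (ResFrac P)).comp (algebraMap A (Localization.AtPrime q))

theorem locRes_eq_zero_iff (a : A) :
    locRes P a = 0 ↔ algebraMap A (Localization.AtPrime q) a ∈ P :=
  algebraMap_resFrac_eq_zero_iff P _

/-- A proper ideal lies in the maximal ideal. This makes the residue field of `q` a specialization
of that of `P`, so ranks can only drop from `P` to `q`. -/
theorem mem_of_locRes_eq_zero [hP : P.IsPrime] {a : A} (h : locRes P a = 0) : a ∈ q :=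
  (IsLocalization.AtPrime.to_map_mem_maximal_iff (Localization.AtPrime q) q a).1
    (IsLocalRing.le_maximalIdeal hP.ne_top ((locRes_eq_zero_iff P a).1 h))

theorem exists_eq_locRes_div [P.IsPrime] (x : ResFrac P) :
    ∃ a b, locRes P b ≠ 0 ∧ x = locRes P a / locRes P b := by
  obtain ⟨y, z, hz, rfl⟩ := IsFractionRing.div_surjective (A := Localization.AtPrime q ⧸ P) x
  obtain ⟨y, rfl⟩ := Ideal.Quotient.mk_surjective y
  obtain ⟨z, rfl⟩ := Ideal.Quotient.mk_surjective z
  obtain ⟨⟨a, s⟩, hs⟩ := IsLocalization.surj q.primeCompl y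
  obtain ⟨⟨b, t⟩, ht⟩ := IsLocalization.surj q.primeCompl z
  have hne : ∀ u : q.primeCompl, locRes P u ≠ 0 := fun u hu => u.2 (mem_of_locRes_eq_zero P hu)
  have hy : algebraMap _ (ResFrac P) y * locRes P s = locRes P a := by
    rw [RingHom.comp_apply, ← map_mul, hs, RingHom.comp_apply]
  have hz' : algebraMap _ (ResFrac P) z * locRes P t = locRes P b := by
    rw [RingHom.comp_apply, ← map_mul, ht, RingHom.comp_apply]
  have hz0 : algebraMap _ (ResFrac P) z ≠ 0 := by
    have := nonZeroDivisors.ne_zero hz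
    rw [Ne, algebraMap_resFrac_eq_zero_iff]
    exact fun h => this (Ideal.Quotient.eq_zero_iff_mem.2 h)
  refine ⟨a * t, b * s, ?_, ?_⟩
  · rw [map_mul, ← hz']
    exact mul_ne_zero (mul_ne_zero hz0 (hne t)) (hne s)
  · change algebraMap _ (ResFrac P) y / algebraMap _ (ResFrac P) z = _
    rw [map_mul, map_mul, ← hy, ← hz']
    have := hne s
    have := hne t
    field_simp

/-- Clearing denominators in the local ring; this supplies the hypothesis `hker` of
`MvPolynomial.exists_trdeg_add_rank_jacobian`. -/
theorem exists_mul_mem_span_of_locRes_eq_zero [P.IsPrime] {τ : Type*} (f : τ → A)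
    (hP : P = Ideal.span (Set.range fun j => algebraMap A (Localization.AtPrime q) (f j)))
    (g : A) (hg : locRes P g = 0) :
    ∃ h, locRes P h ≠ 0 ∧ h * g ∈ Ideal.span (Set.range f) := by
  rw [locRes_eq_zero_iff] at hg
  have h1 : P = (Ideal.span (Set.range f)).map (algebraMap A (Localization.AtPrime q)) := by
    rw [hP, Ideal.map_span, ← Set.range_comp]
    rfl
  rw [h1, IsLocalization.algebraMap_mem_map_algebraMap_iff q.primeCompl] at hg
  obtain ⟨h, hh, hhg⟩ := hg
  exact ⟨h, fun h0 => hh (mem_of_locRes_eq_zero P h0), hhg⟩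

end ResidueFields

/-! ### The truncated systems -/

variable {K : Type*} [Field K] {n : ℕ}

theorem ordVal_injective (N : ℕ) : Function.Injective (ordVal K n N) :=
  rename_injective _ Subtype.val_injective

theorem exists_ordVal_eq (g : DiffPoly K n) : ∃ N₀, ∀ N ≥ N₀, ∃ a, ordVal K n N a = g := by
  refine ⟨g.vars.sup Prod.snd, fun N hN => ?_⟩
  have : g ∈ ordSub K n N := mem_supported.2 fun v hv => (Finset.le_sup (f := Prod.snd) hv).trans hN
  exact ⟨restrictMat (N := N) (fun (_ _ : Unit) => g) (fun _ _ => this) () (),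
    ordVal_restrictMat _ _ _ _⟩

theorem ordVal_pderiv {N : ℕ} (v : ↥{v : Fin n × ℕ | v.2 ≤ N}) (a : OrdRing K n N) :
    ordVal K n N (pderiv v a) = pderiv v.1 (ordVal K n N a) :=
  (pderiv_rename Subtype.val_injective v a).symm

instance (N : ℕ) : Finite ↥{v : Fin n × ℕ | v.2 ≤ N} :=
  Finite.of_injective (β := Fin n × Fin (N + 1))
    (fun v => (v.1.1, ⟨v.1.2, Nat.lt_succ_of_le v.2⟩)) fun v w h => by
      simp only [Prod.mk.injEq, Fin.mk.injEq] at h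
      exact Subtype.ext (Prod.ext h.1 h.2)

instance (N : ℕ) : Fintype ↥{v : Fin n × ℕ | v.2 ≤ N} := Fintype.ofFinite _

variable (σ : K →+* K) {r : ℕ} (f : Fin r → DiffPoly K n)

/-- The system of the `f_j^{(l)}`, `l < m`, as elements of `A_N`. -/
def lowSys {N m : ℕ} (h : m + sysOrder f ≤ N + 1) (a : Fin m × Fin r) : OrdRing K n N :=
  restrictMat (fun (a : Fin m × Fin r) (_ : Unit) => transform σ a.1 (f a.2))
    (fun a _ => ordSub_mono (by have := a.1.2; omega) (transform_mem σ f a.2 a.1)) a ()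

theorem ordVal_lowSys {N m : ℕ} (h : m + sysOrder f ≤ N + 1) (a : Fin m × Fin r) :
    ordVal K n N (lowSys σ f h a) = transform σ a.1 (f a.2) :=
  ordVal_restrictMat _ _ _ _

theorem mem_contr_iff (p : Ideal (DiffPoly K n)) {N : ℕ} (a : OrdRing K n N) :
    a ∈ contr p N ↔ ordVal K n N a ∈ p := Iff.rfl

theorem transform_mem_of_isDiffIdeal {I : Ideal (DiffPoly K n)} (hI : IsDiffIdeal (shift σ) I)
    {g : DiffPoly K n} (hg : g ∈ I) (l : ℕ) : transform σ l g ∈ I := by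
  induction l with
  | zero => exact hg
  | succ l ih =>
    rw [transform, Function.iterate_succ_apply']
    exact hI _ ih

theorem mem_of_diffSpan_le {I : Ideal (DiffPoly K n)}
    (h : diffSpan (shift σ) (Set.range f) ≤ I) (j : Fin r) : f j ∈ I :=
  h (Submodule.mem_sInf.2 fun _ hJ => hJ.1 ⟨j, rfl⟩)

theorem lowSys_mem_contr {p : Ideal (DiffPoly K n)} (hp : IsDiffPrime (shift σ) p)
    (hF : diffSpan (shift σ) (Set.range f) ≤ p) {N m : ℕ} (h : m + sysOrder f ≤ N + 1)
    (a : Fin m × Fin r) : lowSys σ f h a ∈ contr p N := by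
  rw [mem_contr_iff, ordVal_lowSys]
  exact transform_mem_of_isDiffIdeal σ hp.isDiffIdeal (mem_of_diffSpan_le σ f hF _) _

variable (p : Ideal (DiffPoly K n)) [p.IsPrime]

theorem deltaIdeal_eq_span {N m : ℕ} (h : m + sysOrder f ≤ N + 1) :
    deltaIdeal σ f p N m = Ideal.span (Set.range fun a =>
      algebraMap (OrdRing K n N) (LocRing p N) (lowSys σ f h a)) := by
  refine congrArg Ideal.span (Set.ext fun x => ⟨?_, ?_⟩)
  · rintro ⟨a, ⟨l, hl, j, hj⟩, rfl⟩
    refine ⟨(⟨l, hl⟩, j), ?_⟩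
    have : lowSys σ f h (⟨l, hl⟩, j) = a :=
      ordVal_injective N (by rw [hj, ordVal_lowSys])
    exact congrArg _ this
  · rintro ⟨a, rfl⟩
    exact ⟨_, ⟨a.1, a.1.2, a.2, ordVal_lowSys σ f h a⟩, rfl⟩

variable {p}

/-! ### Consequences of quasi-regularity -/

/-- The column of the full Jacobian matrix belonging to a variable of order at most `N`. -/
def ordVar {N q : ℕ} (h : q ≤ N + 1) (b : Fin q × Fin n) : ↥{v : Fin n × ℕ | v.2 ≤ N} :=
  ⟨(b.2, (b.1 : ℕ)), by have := b.1.2; simp only [Set.mem_ofPred_eq]; omega⟩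

theorem rank_map_jacobian_lowSys {hp : IsDiffPrime (shift σ) p} (hqr : IsQuasiRegularAt σ f p hp)
    {N m : ℕ} (h : m + sysOrder f = N + 1) :
    (Matrix.map (fun a b => pderiv (ordVar h.le b) (lowSys σ f h.le a))
      (algebraMap (OrdRing K n N) (ResFrac (contr p N)))).rank = m * r := by
  -- Quasi-regularity speaks only of $k\ge1$; the empty system has rank $0$.
  rcases Nat.eq_zero_or_pos m with rfl | hm
  · rw [zero_mul, ← Nat.le_zero]
    exact (Matrix.rank_le_card_height _).trans (by simp)
  · obtain rfl : N = m - 1 + sysOrder f := by omega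
    rw [← hqr.full_rank m hm]
    congr 2
    refine funext fun a => funext fun b => ordVal_injective _ ?_
    rw [ordVal_restrictMat, ordVal_pderiv, ordVal_lowSys]
    rfl

theorem deltaIdeal_isPrime {hp : IsDiffPrime (shift σ) p} (hqr : IsQuasiRegularAt σ f p hp)
    (hF : diffSpan (shift σ) (Set.range f) ≤ p) {N m : ℕ} (h : m + sysOrder f = N + 1) :
    (deltaIdeal σ f p N m).IsPrime := by
  rw [deltaIdeal_eq_span σ f p h.le]
  refine isPrime_span_of_linearIndependent_jacobian (contr p N) (lowSys σ f h.le)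
    (lowSys_mem_contr σ f hp hF h.le) (algebraMap _ (ResFrac (contr p N)))
    (Ideal.ext fun x => algebraMap_resFrac_eq_zero_iff _ x) ?_
  refine LinearIndependent.of_comp (LinearMap.funLeft _ _ (ordVar h.le)) ?_
  rw [linearIndependent_iff_card_eq_finrank_span, Set.finrank]
  have := rank_map_jacobian_lowSys σ f hqr h
  rw [Matrix.rank_eq_finrank_span_row] at this
  rw [Fintype.card_prod, Fintype.card_fin, Fintype.card_fin, ← this]
  rfl

theorem ordVar_injective {N q : ℕ} (h : q ≤ N + 1) :
    Function.Injective (ordVar h : Fin q × Fin n → _) := fun a b hab => by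
  have := congrArg Subtype.val hab
  simp only [ordVar, Prod.mk.injEq] at this
  exact Prod.ext (Fin.ext this.2) this.1

theorem ordVar_surjective {N q : ℕ} (h : q = N + 1) :
    Function.Surjective (ordVar h.le : Fin q × Fin n → _) := fun v =>
  ⟨(⟨v.1.2, by have : v.1.2 ≤ N := v.2; omega⟩, v.1.1), rfl⟩

theorem locRes_lowSys {N m : ℕ} (h : m + sysOrder f ≤ N + 1) {P : Ideal (LocRing p N)}
    (hP : P = deltaIdeal σ f p N m) (a : Fin m × Fin r) : locRes P (lowSys σ f h a) = 0 := by
  rw [locRes_eq_zero_iff, hP, deltaIdeal_eq_span σ f p h]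
  exact Ideal.subset_span ⟨a, rfl⟩

/-- Here every variable is chosen, so the base field is `K`. The rank is at most the number of rows,
and at least the full rank it has after specialization to the residue field of `contr p N`. -/
theorem trdeg_resFrac_deltaIdeal [CharZero K] {hp : IsDiffPrime (shift σ) p}
    (hqr : IsQuasiRegularAt σ f p hp) {N m : ℕ} (h : m + sysOrder f = N + 1)
    {P : Ideal (LocRing p N)} (hP : P = deltaIdeal σ f p N m) [P.IsPrime] :
    ∃ t : ℕ, Algebra.trdeg K (ResFrac P) = t ∧ t + m * r = (N + 1) * n := by
  have hsupp : (Set.range (ordVar h.le : Fin (m + sysOrder f) × Fin n → _))ᶜ = ∅ := by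
    rw [Set.compl_empty_iff, Set.range_eq_univ]
    exact ordVar_surjective h
  have hC : ∀ x, locRes P (C x) = algebraMap K (ResFrac P) x := fun x => rfl
  let M : Matrix (Fin m × Fin r) (Fin (m + sysOrder f) × Fin n) (OrdRing K n N) :=
    fun a b => pderiv (ordVar h.le b) (lowSys σ f h.le a)
  have hrank : (M.map (locRes P)).rank = m * r := by
    refine le_antisymm ((Matrix.rank_le_card_height _).trans (by simp)) ?_
    rw [← rank_map_jacobian_lowSys σ f hqr h]
    exact Matrix.rank_map_le_of_specialization _ _ (fun x hx =>
      (algebraMap_resFrac_eq_zero_iff _ _).2 (mem_of_locRes_eq_zero P hx)) M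
  obtain ⟨t, ht, hr⟩ := exists_trdeg_add_rank_jacobian (E := K) (locRes P)
    (exists_eq_locRes_div P) (lowSys σ f h.le) (locRes_lowSys σ f h.le hP)
    (exists_mul_mem_span_of_locRes_eq_zero P _ (hP.trans (deltaIdeal_eq_span σ f p h.le)))
    (ordVar h.le) (ordVar_injective h.le)
    (fun a ha => by
      rw [hsupp, supported_empty] at ha
      obtain ⟨x, rfl⟩ := Algebra.mem_bot.1 ha
      exact ⟨x, (hC x).symm⟩)
    (fun x => ⟨C x, Subalgebra.algebraMap_mem _ x, 1, one_mem _, by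
      rw [map_one]; exact one_ne_zero, by rw [map_one, div_one, hC]⟩)
    (M.map (locRes P)) (fun w => funext_iff)
  refine ⟨t, ht, ?_⟩
  rw [hrank, Fintype.card_prod, Fintype.card_fin, Fintype.card_fin, h] at hr
  exact hr

/-- The variables of order between `i + 1` and `i + k`. -/
def topVar (k i : ℕ) (b : Fin k × Fin n) : ↥{v : Fin n × ℕ | v.2 ≤ i + k} :=
  ⟨(b.2, i + 1 + b.1), by have := b.1.2; simp only [Set.mem_ofPred_eq]; omega⟩

theorem topVar_injective (k i : ℕ) :
    Function.Injective (topVar k i : Fin k × Fin n → _) := fun a b hab => by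
  have := congrArg Subtype.val hab
  simp only [topVar, Prod.mk.injEq, Nat.add_left_cancel_iff] at this
  exact Prod.ext (Fin.ext this.2) this.1

theorem supported_compl_range_topVar (k i : ℕ) :
    supported K (Set.range (topVar k i : Fin k × Fin n → _))ᶜ =
      (ordIncl K n (Nat.le_add_right i k)).range := by
  have hset : (Set.range (topVar k i : Fin k × Fin n → _))ᶜ =
      Set.range fun v : ↥{v : Fin n × ℕ | v.2 ≤ i} =>
        (⟨v.1, le_trans v.2 (Nat.le_add_right i k)⟩ : ↥{v : Fin n × ℕ | v.2 ≤ i + k}) := by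
    ext v
    have hv : v.1.2 ≤ i + k := v.2
    constructor
    · intro h
      refine ⟨⟨v.1, ?_⟩, rfl⟩
      by_contra hlt
      have hlt : ¬ v.1.2 ≤ i := hlt
      refine h ⟨(⟨v.1.2 - (i + 1), by omega⟩, v.1.1), Subtype.ext (Prod.ext rfl ?_)⟩
      change i + 1 + (v.1.2 - (i + 1)) = v.1.2
      omega
    · rintro ⟨w, rfl⟩ ⟨b, hb⟩
      have h1 : i + 1 + (b.1 : ℕ) = w.1.2 := congrArg (fun u => u.1.2) hb
      have h2 : w.1.2 ≤ i := w.2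
      omega
  rw [supported, hset, ← Algebra.map_top, ← adjoin_range_X, AlgHom.map_adjoin, ← Set.range_comp,
    ← Set.range_comp]
  congr 2
  funext v
  simp [ordIncl]

theorem pseudoJac_eq_pderiv_lowSys {k i : ℕ} (hi : sysOrder f ≤ i + 1)
    (h : i + 1 - sysOrder f + k + sysOrder f ≤ i + k + 1) (a : Fin k × Fin r)
    (b : Fin k × Fin n) :
    restrictMat (N := i + k) (pseudoJac σ f k i) (pseudoJac_mem σ f hi le_rfl) a b =
      pderiv (topVar k i b) (lowSys σ f h (Fin.natAdd _ a.1, a.2)) := by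
  refine ordVal_injective _ ?_
  rw [ordVal_restrictMat, ordVal_pderiv, ordVal_lowSys]
  rfl

theorem pderiv_topVar_lowSys_eq_zero {k i : ℕ}
    (h : i + 1 - sysOrder f + k + sysOrder f ≤ i + k + 1) (l : Fin (i + 1 - sysOrder f))
    (j : Fin r) (b : Fin k × Fin n) :
    pderiv (topVar k i b) (lowSys σ f h (Fin.castAdd _ l, j)) = 0 := by
  refine ordVal_injective _ ?_
  rw [ordVal_pderiv, ordVal_lowSys, map_zero]
  refine pderiv_eq_zero_of_notMem_vars fun hv => ?_
  have h1 : i + 1 + (b.1 : ℕ) ≤ l + sysOrder f :=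
    mem_supported.1 (transform_mem σ f j l) hv
  have := l.2
  omega

/-- The chosen variables are those of order above `i`; the remaining ones generate the fraction
field attached to the contraction of $\Delta_{i-e+1+k}$ to $B_i$. -/
theorem trdeg_resFracMap_delta [CharZero K] {k i : ℕ} (hi : sysOrder f ≤ i + 1)
    (hP : (Delta σ f p i k).IsPrime) :
    ∃ t : ℕ, @Algebra.trdeg
      (ResFrac ((Delta σ f p i k).comap (locIncl p (Nat.le_add_right i k))))
      (ResFrac (Delta σ f p i k)) _ _
      (resFracMap (locIncl p (Nat.le_add_right i k)) (Delta σ f p i k) hP).toAlgebra = t ∧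
      t + deltaRank σ f p k i 0 hi = k * n := by
  have h : i + 1 - sysOrder f + k + sysOrder f ≤ i + k + 1 := by omega
  set P := Delta σ f p i k with hPdef
  have hPi : (P.comap (locIncl p (Nat.le_add_right i k))).IsPrime := Ideal.comap_isPrime _ _
  let _ : Algebra (ResFrac (P.comap (locIncl p (Nat.le_add_right i k)))) (ResFrac P) :=
    (resFracMap (locIncl p (Nat.le_add_right i k)) P hP).toAlgebra
  have hmap : ∀ a, algebraMap (ResFrac (P.comap (locIncl p (Nat.le_add_right i k)))) (ResFrac P)
      (locRes _ a) = locRes P (ordIncl K n (Nat.le_add_right i k) a) := by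
    intro a
    refine (resFracMap_algebraMap _ P hP _).trans ?_
    rw [RingHom.comp_apply, locIncl, Localization.localRingHom_to_map]
    rfl
  have : CharZero (ResFrac (P.comap (locIncl p (Nat.le_add_right i k)))) :=
    charZero_of_injective_algebraMap (algebraMap K _).injective
  let M : Matrix (Fin k × Fin r) (Fin k × Fin n) (OrdRing K n (i + k)) :=
    restrictMat (N := i + k) (pseudoJac σ f k i) (pseudoJac_mem σ f hi le_rfl)
  obtain ⟨t, ht, hr⟩ := exists_trdeg_add_rank_jacobian
    (E := ResFrac (P.comap (locIncl p (Nat.le_add_right i k)))) (locRes P)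
    (exists_eq_locRes_div P) (lowSys σ f h) (locRes_lowSys σ f h hPdef)
    (exists_mul_mem_span_of_locRes_eq_zero P _ (hPdef.trans (deltaIdeal_eq_span σ f p h)))
    (topVar k i) (topVar_injective k i)
    (fun a ha => by
      rw [supported_compl_range_topVar] at ha
      obtain ⟨a, rfl⟩ := ha
      exact ⟨locRes _ a, hmap a⟩)
    (fun x => by
      obtain ⟨a, b, hb, rfl⟩ := exists_eq_locRes_div _ x
      rw [supported_compl_range_topVar]
      refine ⟨_, ⟨a, rfl⟩, _, ⟨b, rfl⟩, ?_, ?_⟩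
      · exact (hmap b).symm.trans_ne ((map_ne_zero _).2 hb)
      · rw [map_div₀, hmap, hmap]
        rfl)
    -- Only kernels are compared, so the rows of the equations with $l<i-e+1$ may be dropped: those
    -- have order at most `i` and their derivatives vanish.
    (M.map (locRes P)) (fun w => by
      rw [funext_iff]
      constructor
      · rintro hw ⟨l, j⟩
        refine Fin.addCases (fun l => ?_) (fun l => ?_) l
        · refine Finset.sum_eq_zero fun b _ => ?_
          rw [pderiv_topVar_lowSys_eq_zero σ f h, map_zero, zero_mul]
        · refine Eq.trans (Finset.sum_congr rfl fun b _ => ?_) (hw (l, j))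
          rw [← pseudoJac_eq_pderiv_lowSys σ f hi h (l, j) b]
          rfl
      · rintro hw ⟨l, j⟩
        refine Eq.trans (Finset.sum_congr rfl fun b _ => ?_) (hw (Fin.natAdd _ l, j))
        rw [← pseudoJac_eq_pderiv_lowSys σ f hi h (l, j) b]
        rfl)
  refine ⟨t, ht, ?_⟩
  rw [Fintype.card_prod, Fintype.card_fin, Fintype.card_fin] at hr
  exact hr

/-! ### Independence of `μ_{k,i}` of `i` -/

theorem pderiv_shift (v : Fin n × ℕ) (g : DiffPoly K n) :
    pderiv (v.1, v.2 + 1) (shift σ g) = shift σ (pderiv v g) := by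
  classical
  have hX : ∀ w : Fin n × ℕ, shift σ (X w : DiffPoly K n) = X (w.1, w.2 + 1) := fun w => by
    simp [shift]
  have hC : ∀ x, shift σ (C x : DiffPoly K n) = C (σ x) := fun x => by simp [shift]
  induction g using MvPolynomial.induction_on with
  | C x => simp [hC]
  | add p q hp hq => simp [hp, hq]
  | mul_X g w hg =>
    rw [map_mul, pderiv_mul, hg, pderiv_mul, map_add, map_mul, map_mul, hX]
    by_cases h : w = v
    · subst h
      simp
    · rw [pderiv_X_of_ne h, pderiv_X_of_ne, map_zero]
      simpa [Prod.ext_iff] using h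

/-- Differentiation commutes with the shift once the variable is shifted too. `hi` makes the
truncated subtraction in the index exact. -/
theorem pseudoJac_succ (k : ℕ) {i : ℕ} (hi : sysOrder f ≤ i + 1) :
    pseudoJac σ f k (i + 1) = (pseudoJac σ f k i).map (shift σ) := by
  refine funext fun a => funext fun b => ?_
  have h1 : transform σ (i + 1 + 1 - sysOrder f + a.1) (f a.2) =
      shift σ (transform σ (i + 1 - sysOrder f + a.1) (f a.2)) := by
    rw [transform, show i + 1 + 1 - sysOrder f + (a.1 : ℕ) = i + 1 - sysOrder f + a.1 + 1 by omega,
      Function.iterate_succ_apply']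
    rfl
  rw [Matrix.map_apply, pseudoJac, pseudoJac, h1, ← pderiv_shift]
  congr 3
  omega

variable (p) in
theorem muAt_add_rank (k i : ℕ) :
    muAt σ f p k i + ((pseudoJac σ f k i).map (algebraMap _ (ResFrac p))).rank = k * r := by
  rw [← Matrix.rank_transpose, muAt, add_comm, Matrix.rank,
    LinearMap.finrank_range_add_finrank_ker, Module.finrank_fintype_fun_eq_card,
    Fintype.card_prod, Fintype.card_fin, Fintype.card_fin]

/-- Stability and reflexivity of `p` say that reduction modulo `p`, with or without a preceding
shift, has the same kernel. Each is a specialization of the other, so the ranks agree. -/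
theorem muAt_succ (hp : IsDiffPrime (shift σ) p) (k : ℕ) {i : ℕ} (hi : sysOrder f ≤ i + 1) :
    muAt σ f p k (i + 1) = muAt σ f p k i := by
  have h1 := muAt_add_rank σ f p k i
  have h2 := muAt_add_rank σ f p k (i + 1)
  have h3 : ∀ x, algebraMap _ (ResFrac p) x = 0 ↔
      ((algebraMap _ (ResFrac p)).comp (shift σ)) x = 0 := fun x => by
    rw [RingHom.comp_apply, algebraMap_resFrac_eq_zero_iff, algebraMap_resFrac_eq_zero_iff]
    exact ⟨hp.isDiffIdeal x, hp.isReflexive x⟩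
  have h4 := le_antisymm
    (Matrix.rank_map_le_of_specialization _ _ (fun x => (h3 x).1) (pseudoJac σ f k i))
    (Matrix.rank_map_le_of_specialization _ _ (fun x => (h3 x).2) (pseudoJac σ f k i))
  rw [pseudoJac_succ σ f k hi, Matrix.map_map, ← RingHom.coe_comp, h4] at h2
  omega

theorem muAt_eq_mu (hp : IsDiffPrime (shift σ) p) (he : 1 ≤ sysOrder f) (k i : ℕ)
    (hi : sysOrder f ≤ i + 1) : muAt σ f p k i = mu σ f p k := by
  obtain ⟨d, rfl⟩ := Nat.exists_eq_add_of_le (show sysOrder f - 1 ≤ i by omega)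
  induction d with
  | zero => rfl
  | succ d ih => rw [← add_assoc, muAt_succ σ f hp k (by omega), ih (by omega)]

/-! ### The difference ideal `Δ` is the union of the `Δ_m` -/

/-- A membership certificate involves finitely many transforms and coefficients, all of which lie in
$A_N$ for large `N`. -/
theorem exists_lowSys_span_of_mem_span {x : DiffPoly K n}
    (hx : x ∈ Ideal.span {x | ∃ l j, x = transform σ l (f j)}) :
    ∃ N₀, ∀ N ≥ N₀, ∀ m (h : m + sysOrder f = N + 1),
      ∃ a ∈ Ideal.span (Set.range (lowSys σ f h.le)), ordVal K n N a = x := by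
  induction hx using Submodule.span_induction with
  | mem x hx =>
    obtain ⟨l, j, rfl⟩ := hx
    refine ⟨l + sysOrder f, fun N hN m h => ⟨_, Ideal.subset_span ⟨(⟨l, by omega⟩, j), rfl⟩, ?_⟩⟩
    rw [ordVal_lowSys]
  | zero => exact ⟨0, fun N _ m h => ⟨0, zero_mem _, map_zero _⟩⟩
  | add x y _ _ hx hy =>
    obtain ⟨N₁, h₁⟩ := hx
    obtain ⟨N₂, h₂⟩ := hy
    refine ⟨max N₁ N₂, fun N hN m h => ?_⟩
    obtain ⟨a, ha, hax⟩ := h₁ N (le_of_max_le_left hN) m h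
    obtain ⟨b, hb, hby⟩ := h₂ N (le_of_max_le_right hN) m h
    exact ⟨a + b, add_mem ha hb, by rw [map_add, hax, hby]⟩
  | smul c x _ hx =>
    obtain ⟨N₁, h₁⟩ := hx
    obtain ⟨N₂, h₂⟩ := exists_ordVal_eq c
    refine ⟨max N₁ N₂, fun N hN m h => ?_⟩
    obtain ⟨a, ha, hax⟩ := h₁ N (le_of_max_le_left hN) m h
    obtain ⟨b, hb⟩ := h₂ N (le_of_max_le_right hN)
    exact ⟨b * a, Ideal.mul_mem_left _ _ ha, by rw [map_mul, hax, hb, smul_eq_mul]⟩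

theorem ordVal_mem_span_of_mem_span {N m : ℕ} (h : m + sysOrder f ≤ N + 1) {a : OrdRing K n N}
    (ha : a ∈ Ideal.span (Set.range (lowSys σ f h))) :
    ordVal K n N a ∈ Ideal.span {x | ∃ l j, x = transform σ l (f j)} := by
  have hle : Ideal.span (Set.range (lowSys σ f h)) ≤
      (Ideal.span {x | ∃ l j, x = transform σ l (f j)}).comap (ordVal K n N) := by
    rw [Ideal.span_le]
    rintro _ ⟨a, rfl⟩
    rw [SetLike.mem_coe, Ideal.mem_comap, ordVal_lowSys]
    exact Ideal.subset_span ⟨_, _, rfl⟩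
  exact hle ha

theorem isDiffIdeal_diffSpan {R : Type*} [CommRing R] (τ : R →+* R) (S : Set R) :
    IsDiffIdeal τ (diffSpan τ S) := fun _ ha =>
  Submodule.mem_sInf.2 fun I hI => hI.2 _ (Submodule.mem_sInf.1 ha I hI)

theorem subset_diffSpan {R : Type*} [CommRing R] (τ : R →+* R) (S : Set R) :
    S ⊆ diffSpan τ S := fun _ ha =>
  Submodule.mem_sInf.2 fun _ hI => hI.1 ha

theorem locShift_algebraMap (hp : IsDiffPrime (shift σ) p) (g : DiffPoly K n) :
    locShift σ p hp (algebraMap _ _ g) = algebraMap _ _ (shift σ g) :=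
  Localization.localRingHom_to_map _ _ _ _ _

/-- The ideal generated by all transforms is already stable under the shift, so no further closure
is needed after localizing. -/
theorem deltaTop_eq_map (hp : IsDiffPrime (shift σ) p) :
    deltaTop σ f p hp = (Ideal.span {x | ∃ l j, x = transform σ l (f j)}).map
      (algebraMap (DiffPoly K n) (Localization.AtPrime p)) := by
  refine le_antisymm (sInf_le ⟨?_, ?_⟩) ?_
  · rintro _ ⟨j, rfl⟩
    exact Ideal.mem_map_of_mem _ (Ideal.subset_span ⟨0, j, rfl⟩)
  · intro x hx
    rw [← Ideal.mem_comap]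
    refine (Ideal.map_le_iff_le_comap.2 (Ideal.span_le.2 ?_)) hx
    rintro _ ⟨l, j, rfl⟩
    rw [SetLike.mem_coe, Ideal.mem_comap, Ideal.mem_comap, locShift_algebraMap]
    refine Ideal.mem_map_of_mem _ (Ideal.subset_span ⟨l + 1, j, ?_⟩)
    rw [transform, transform, Function.iterate_succ_apply']
  · rw [Ideal.map_le_iff_le_comap, Ideal.span_le]
    rintro _ ⟨l, j, rfl⟩
    rw [SetLike.mem_coe, Ideal.mem_comap]
    induction l with
    | zero => exact subset_diffSpan _ _ ⟨j, rfl⟩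
    | succ l ih =>
      rw [transform, Function.iterate_succ_apply', ← locShift_algebraMap σ hp]
      exact isDiffIdeal_diffSpan _ _ _ ih

theorem mem_deltaIdeal_iff {N m : ℕ} (h : m + sysOrder f ≤ N + 1) (a : OrdRing K n N) :
    algebraMap _ (LocRing p N) a ∈ deltaIdeal σ f p N m ↔
      ∃ b ∉ contr p N, b * a ∈ Ideal.span (Set.range (lowSys σ f h)) := by
  have h1 : deltaIdeal σ f p N m = (Ideal.span (Set.range (lowSys σ f h))).map
      (algebraMap _ (LocRing p N)) := by
    rw [deltaIdeal_eq_span σ f p h, Ideal.map_span, ← Set.range_comp]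
    rfl
  rw [h1, IsLocalization.algebraMap_mem_map_algebraMap_iff (contr p N).primeCompl]
  rfl

theorem mem_deltaTop_of_mem_deltaIdeal (hp : IsDiffPrime (shift σ) p) {N m : ℕ}
    (h : m + sysOrder f ≤ N + 1) {a : OrdRing K n N}
    (ha : algebraMap _ (LocRing p N) a ∈ deltaIdeal σ f p N m) :
    algebraMap _ _ (ordVal K n N a) ∈ deltaTop σ f p hp := by
  obtain ⟨b, hb, hba⟩ := (mem_deltaIdeal_iff σ f h a).1 ha
  rw [deltaTop_eq_map, IsLocalization.algebraMap_mem_map_algebraMap_iff p.primeCompl]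
  refine ⟨ordVal K n N b, hb, ?_⟩
  rw [← map_mul]
  exact ordVal_mem_span_of_mem_span σ f h hba

theorem exists_mem_deltaIdeal_of_mem_deltaTop (hp : IsDiffPrime (shift σ) p) {g : DiffPoly K n}
    (hg : algebraMap _ _ g ∈ deltaTop σ f p hp) :
    ∃ N₀, ∀ N ≥ N₀, ∀ m, m + sysOrder f = N + 1 → ∀ a, ordVal K n N a = g →
      algebraMap _ (LocRing p N) a ∈ deltaIdeal σ f p N m := by
  rw [deltaTop_eq_map, IsLocalization.algebraMap_mem_map_algebraMap_iff p.primeCompl] at hg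
  obtain ⟨b, hb, hbg⟩ := hg
  obtain ⟨N₁, h₁⟩ := exists_lowSys_span_of_mem_span σ f hbg
  obtain ⟨N₂, h₂⟩ := exists_ordVal_eq b
  refine ⟨max N₁ N₂, fun N hN m h a ha => ?_⟩
  obtain ⟨c, hc, hcx⟩ := h₁ N (le_of_max_le_left hN) m h
  obtain ⟨b', hb'⟩ := h₂ N (le_of_max_le_right hN)
  refine (mem_deltaIdeal_iff σ f h.le a).2 ⟨b', fun hmem => hb ?_, ?_⟩
  · rwa [mem_contr_iff, hb'] at hmem
  · have : b' * a = c := ordVal_injective N (by rw [map_mul, hb', ha, hcx])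
    rwa [this]

/-- At a minimal `σ`-prime ideal `p` over a quasi-regular system, `Δ` is the maximal ideal. -/
theorem algebraMap_mem_deltaTop_of_mem {hp : IsDiffPrime (shift σ) p}
    (hmin : Minimal
      (fun q => IsDiffPrime (shift σ) q ∧ diffSpan (shift σ) (Set.range f) ≤ q) p)
    (hqr : IsQuasiRegularAt σ f p hp) {g : DiffPoly K n} (hg : g ∈ p) :
    algebraMap _ _ g ∈ deltaTop σ f p hp := by
  have hF := hmin.1.2
  let Q := (deltaTop σ f p hp).comap (algebraMap (DiffPoly K n) (Localization.AtPrime p))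
  have key : ∀ x : DiffPoly K n, x ∈ Q → ∃ N₀, ∀ N ≥ N₀, ∀ m, m + sysOrder f = N + 1 → ∀ a,
      ordVal K n N a = x → algebraMap _ (LocRing p N) a ∈ deltaIdeal σ f p N m := fun x hx =>
    exists_mem_deltaIdeal_of_mem_deltaTop σ f hp hx
  -- An element of `Q` lies in some $\Delta_m$, a proper ideal of a local ring, hence in the maximal
  -- ideal.
  have hQp : Q ≤ p := by
    intro x hx
    obtain ⟨N₀, h₀⟩ := key x hx
    obtain ⟨N₁, h₁⟩ := exists_ordVal_eq x
    let N := max (max N₀ N₁) (sysOrder f)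
    have hm : N + 1 - sysOrder f + sysOrder f = N + 1 := by omega
    obtain ⟨a, rfl⟩ := h₁ N (by omega)
    have ha := h₀ N (by omega) _ hm a rfl
    have := deltaIdeal_isPrime σ f hqr hF hm
    exact (mem_contr_iff p a).1 (mem_of_locRes_eq_zero _ ((locRes_eq_zero_iff _ a).2 ha))
  -- Primality passes from the $\Delta_m$ to their union: a product and both factors are compared at
  -- one common level `N`. Reflexivity is part of quasi-regularity.
  have hQ : IsDiffPrime (shift σ) Q := by
    refine ⟨⟨fun h => ‹p.IsPrime›.ne_top (top_le_iff.1 (h ▸ hQp)), fun {x y} hxy => ?_⟩,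
      fun x hx => ?_, fun x hx => hqr.reflexive _ ?_⟩
    · obtain ⟨N₀, h₀⟩ := key _ hxy
      obtain ⟨N₁, h₁⟩ := exists_ordVal_eq x
      obtain ⟨N₂, h₂⟩ := exists_ordVal_eq y
      let N := max (max N₀ N₁) (max N₂ (sysOrder f))
      have hm : N + 1 - sysOrder f + sysOrder f = N + 1 := by omega
      obtain ⟨a, rfl⟩ := h₁ N (by omega)
      obtain ⟨b, rfl⟩ := h₂ N (by omega)
      have hab := h₀ N (by omega) _ hm (a * b) (map_mul _ _ _)
      rw [map_mul] at hab
      exact ((deltaIdeal_isPrime σ f hqr hF hm).mem_or_mem hab).imp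
        (mem_deltaTop_of_mem_deltaIdeal σ f hp hm.le) (mem_deltaTop_of_mem_deltaIdeal σ f hp hm.le)
    · rw [Ideal.mem_comap, ← locShift_algebraMap σ hp]
      exact isDiffIdeal_diffSpan _ _ _ hx
    · rw [locShift_algebraMap]
      exact hx
  have hFQ : diffSpan (shift σ) (Set.range f) ≤ Q := by
    refine sInf_le ⟨?_, hQ.isDiffIdeal⟩
    rintro _ ⟨j, rfl⟩
    exact subset_diffSpan _ _ ⟨j, rfl⟩
  exact hmin.2 ⟨hQ, hFQ⟩ hQp hg

theorem restrictMat_map_ordVal {ι ι' : Type*} {N : ℕ} (M : Matrix ι ι' (DiffPoly K n))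
    (h : ∀ a b, M a b ∈ ordSub K n N) :
    (restrictMat M h).map (ordVal K n N : OrdRing K n N →+* DiffPoly K n) = M :=
  funext fun _ => funext fun _ => ordVal_restrictMat _ _ _ _

/-- Specialization gives one inequality. The other holds because all elements of `p` become zero
modulo $\Delta_m$ at some finite level, while the rank does not change along the levels. -/
theorem deltaRank_eq_rank {hp : IsDiffPrime (shift σ) p}
    (hmin : Minimal
      (fun q => IsDiffPrime (shift σ) q ∧ diffSpan (shift σ) (Set.range f) ≤ q) p)
    (hqr : IsQuasiRegularAt σ f p hp) (hrank : RankStable σ f p) (k i : ℕ)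
    (hi : sysOrder f ≤ i + 1) :
    deltaRank σ f p k i 0 hi = ((pseudoJac σ f k i).map (algebraMap _ (ResFrac p))).rank := by
  have hF := hmin.1.2
  have hprime : ∀ s, (Delta σ f p i (k + s)).IsPrime := fun s =>
    deltaIdeal_isPrime σ f hqr hF (by omega)
  refine le_antisymm ?_ ?_
  · by_contra! hlt
    set ρ := deltaRank σ f p k i 0 hi with hρ
    have hminor : ∀ ab : (Fin ρ → Fin k × Fin r) × (Fin ρ → Fin k × Fin n),
        ((pseudoJac σ f k i).submatrix ab.1 ab.2).det ∈ p := by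
      intro ab
      by_contra hdet
      refine absurd (Matrix.card_le_rank_of_det_submatrix_ne_zero
        ((pseudoJac σ f k i).map (algebraMap _ (ResFrac p))) ab.1 ab.2 ?_) ?_
      · rw [Matrix.submatrix_map, ← RingHom.mapMatrix_apply, ← RingHom.map_det, Ne,
          algebraMap_resFrac_eq_zero_iff]
        exact hdet
      · rw [Fintype.card_fin]
        exact not_le.2 hlt
    choose N₀ hN₀ using fun ab => exists_mem_deltaIdeal_of_mem_deltaTop σ f hp
      (algebraMap_mem_deltaTop_of_mem σ f hmin hqr (hminor ab))
    -- There are finitely many minors of size `ρ`, so one level lies past all thresholds. There they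
    -- all vanish, yet stability forces the rank to be still `ρ`.
    let s := Finset.univ.sup N₀
    have := hprime s
    let J := restrictMat (N := i + (k + s)) (pseudoJac σ f k i)
      (pseudoJac_mem σ f hi (by omega))
    have hJ : (J.map (locRes (Delta σ f p i (k + s)))).rank = ρ := hrank k i hi s
    obtain ⟨a, b, hab⟩ := (J.map (locRes (Delta σ f p i (k + s)))).exists_det_submatrix_ne_zero
    let a' : Fin ρ → _ := fun x => a (Fin.cast hJ.symm x)
    let b' : Fin ρ → _ := fun x => b (Fin.cast hJ.symm x)
    have hab' : ((J.map (locRes (Delta σ f p i (k + s)))).submatrix a' b').det ≠ 0 := by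
      rw [← Matrix.det_submatrix_equiv_self (finCongr hJ.symm)] at hab
      exact hab
    apply hab'
    rw [Matrix.submatrix_map, ← RingHom.mapMatrix_apply, ← RingHom.map_det, locRes_eq_zero_iff]
    refine hN₀ (a', b') _ ?_ _ (by omega) _ ?_
    · have : N₀ (a', b') ≤ s := Finset.le_sup (Finset.mem_univ _)
      omega
    · change (ordVal K n (i + (k + s)) : OrdRing K n (i + (k + s)) →+* DiffPoly K n) _ = _
      rw [RingHom.map_det, RingHom.mapMatrix_apply, ← Matrix.submatrix_map,
        restrictMat_map_ordVal]
  · have := hprime 0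
    let J := restrictMat (N := i + (k + 0)) (pseudoJac σ f k i)
      (pseudoJac_mem σ f hi (by omega))
    have h1 := Matrix.rank_map_le_of_specialization (locRes (Delta σ f p i (k + 0)))
      ((algebraMap _ (ResFrac p)).comp
        (ordVal K n (i + (k + 0)) : OrdRing K n (i + (k + 0)) →+* DiffPoly K n))
      (fun x hx => (algebraMap_resFrac_eq_zero_iff _ _).2
        ((mem_contr_iff p x).1 (mem_of_locRes_eq_zero _ hx))) J
    rw [RingHom.coe_comp, ← Matrix.map_map, restrictMat_map_ordVal] at h1
    exact h1

end DiffAlg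

end

/-! ### The main theorem: combining the ranks with the tower of fields. -/

open DiffAlg in
theorem mainTheorem8 {K : Type*} [Field K] [CharZero K] (σ : K →+* K) {n r : ℕ}
    (f : Fin r → DiffPoly K n) (p : Ideal (DiffPoly K n)) [p.IsPrime]
    (hp : IsDiffPrime (shift σ) p)
    (hmin : Minimal
      (fun q => IsDiffPrime (shift σ) q ∧ diffSpan (shift σ) (Set.range f) ≤ q) p)
    (he : 1 ≤ sysOrder f)
    (hqr : IsQuasiRegularAt σ f p hp)
    (hrank : RankStable σ f p)
    (k i : ℕ) (hi : sysOrder f ≤ i + 1) :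
    muAt σ f p k i = mu σ f p k ∧
    ∃ hP : (Delta σ f p i k).IsPrime,
      (∃ t : ℕ,
        @Algebra.trdeg (ResFrac ((Delta σ f p i k).comap (locIncl p (Nat.le_add_right i k))))
          (ResFrac (Delta σ f p i k)) _ _
          (resFracMap (locIncl p (Nat.le_add_right i k)) (Delta σ f p i k) hP).toAlgebra = t ∧
        (t : ℤ) = k * ((n : ℤ) - r) + mu σ f p k) ∧
      (∃ t : ℕ,
        Algebra.trdeg K
          (ResFrac ((Delta σ f p i k).comap (locIncl p (Nat.le_add_right i k)))) = t ∧
        (t : ℤ) = ((n : ℤ) - r) * (i + 1) + sysOrder f * r - mu σ f p k) := by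
  have hmu := muAt_eq_mu σ f hp he k i hi
  have hm : i + 1 - sysOrder f + k + sysOrder f = i + k + 1 := by omega
  have hP : (Delta σ f p i k).IsPrime := deltaIdeal_isPrime σ f hqr hmin.1.2 hm
  obtain ⟨t₁, ht₁, h₁⟩ := trdeg_resFracMap_delta σ f hi hP
  obtain ⟨t, ht, h⟩ := trdeg_resFrac_deltaIdeal σ f hqr hm (P := Delta σ f p i k) rfl
  have hsum := muAt_add_rank σ f p k i
  rw [hmu, ← deltaRank_eq_rank σ f hmin hqr hrank k i hi] at hsum
  refine ⟨hmu, hP, ⟨t₁, ht₁, ?_⟩, ?_⟩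
  · zify at h₁ hsum
    linear_combination h₁ - hsum
  · have hPi : ((Delta σ f p i k).comap (locIncl p (Nat.le_add_right i k))).IsPrime :=
      Ideal.comap_isPrime _ _
    let _ : Algebra (ResFrac ((Delta σ f p i k).comap (locIncl p (Nat.le_add_right i k))))
        (ResFrac (Delta σ f p i k)) :=
      (resFracMap (locIncl p (Nat.le_add_right i k)) (Delta σ f p i k) hP).toAlgebra
    have : IsScalarTower K
        (ResFrac ((Delta σ f p i k).comap (locIncl p (Nat.le_add_right i k))))
        (ResFrac (Delta σ f p i k)) := by
      refine IsScalarTower.of_algebraMap_eq fun x => ?_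
      refine Eq.trans ?_ (resFracMap_algebraMap (locIncl p (Nat.le_add_right i k)) _ hP
        (algebraMap (OrdRing K n i) _ (MvPolynomial.C x))).symm
      rw [locIncl, Localization.localRingHom_to_map, RingHom.coe_coe, ordIncl,
        MvPolynomial.rename_C]
      rfl
    have : FaithfulSMul K (ResFrac ((Delta σ f p i k).comap (locIncl p (Nat.le_add_right i k)))) :=
      (faithfulSMul_iff_algebraMap_injective _ _).2 (algebraMap K _).injective
    have : FaithfulSMul (ResFrac ((Delta σ f p i k).comap (locIncl p (Nat.le_add_right i k))))
        (ResFrac (Delta σ f p i k)) :=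
      (faithfulSMul_iff_algebraMap_injective _ _).2 (RingHom.injective _)
    -- The lower degree is the total minus the relative one; as a summand of a finite cardinal it is
    -- a natural number.
    have htower := trdeg_add_eq K
      (ResFrac ((Delta σ f p i k).comap (locIncl p (Nat.le_add_right i k))))
      (A := ResFrac (Delta σ f p i k))
    rw [ht, ht₁] at htower
    obtain ⟨t₂, ht₂⟩ := Cardinal.lt_aleph0.1
      ((self_le_add_right _ _).trans_lt (htower.trans_lt (Cardinal.natCast_lt_aleph0)))
    refine ⟨t₂, ht₂, ?_⟩
    rw [ht₂] at htower
    have h₂ : t₂ + t₁ = t := by exact_mod_cast htower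
    -- The subtraction is exact because $i\ge e-1$; the term $er$ of the formula arises from it.
    have hie : ((i + 1 - sysOrder f : ℕ) : ℤ) = i + 1 - sysOrder f := by
      rw [Nat.cast_sub hi]
      push_cast
      ring
    zify at h h₁ h₂ hsum
    rw [hie] at h
    linear_combination h₂ + h - h₁ + hsum
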